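/- Let $\mathcal T$ be a set of primes such that, for some real constants $0<\tau<1$ and $C$, \[ \sum_{p\le x,\; p\in\mathcal T}\frac{\log p}{p}=\tau\log x+C+o(1)\qquad (x\to\infty). \] Let $\mathcal Q(\mathcal T)$ be the set of positive integers $n$ such that every prime $p$ dividing $n$ lies in $\mathcal T$. Then there is a constant $K>0$, depending only on $\mathcal T$, with the following property. Suppose that $\mathcal A,\mathcal B$ are sets of positive integers, with at least two elements each, such that $\mathcal Q(\mathcal T)\sim\mathcal A+\mathcal B$; that is, there is some $x_0$ with \[ (\mathcal A+\mathcal B)\cap[x_0,\infty)=\mathcal Q(\mathcal T)\cap[x_0,\infty), \qquad \mathcal A+\mathcal B=\{a+b: a\in\mathcal A,\ b\in\mathcal B\}. \] Then \[ \max(\mathcal A(x),\mathcal B(x))\le K\,x^{1/2}(\log x)^4 \] for all sufficiently large real $x$ (how large may depend on $\mathcal T,\mathcal A,\mathcal B$), where $\mathcal A(x)=\#\{n\le x: n\in\mathcal A\}$ and $\mathcal B(x)=\#\{n\le x: n\in\mathcal B\}$. -/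

import Mathlib

open Filter Asymptotics

/-- `𝒬(𝒯)`: the positive integers all of whose prime factors lie in `T`. -/
def primeSemigroup (T : Set ℕ) : Set ℕ :=
  {n | 0 < n ∧ ∀ p : ℕ, p.Prime → p ∣ n → p ∈ T}

/-- The counting function `A(x) = #{n ≤ x : n ∈ A}` at a real number `x`. -/
noncomputable def countingFn (A : Set ℕ) (x : ℝ) : ℕ :=
  {n : ℕ | n ∈ A ∧ (n : ℝ) ≤ x}.ncard

open scoped Classical in
/-- The sum of `log p / p` over the elements `p ≤ x` of a set `T` of primes. -/
noncomputable def logPrimeSum (T : Set ℕ) (x : ℝ) : ℝ :=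
  ∑ p ∈ (Finset.Icc 1 ⌊x⌋₊).filter (fun p => p ∈ T), Real.log (p : ℝ) / (p : ℝ)

open scoped Pointwise in
/-- `S ∼ A + B`: the sets `A`, `B` consist of positive integers, have at least two elements each,
and the sumset `A + B` coincides with `S` from some point on. -/
structure IsAsymptoticDecomposition (S A B : Set ℕ) : Prop where
  pos_left : ∀ a ∈ A, 0 < a
  pos_right : ∀ b ∈ B, 0 < b
  two_le_left : 2 ≤ A.encard
  two_le_right : 2 ≤ B.encard
  eventually_eq : ∃ x₀ : ℕ, (A + B) ∩ Set.Ici x₀ = S ∩ Set.Ici x₀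

/-! Let `U` be the set of primes outside `T`; by Mertens' theorem it has logarithmic density `1 - τ
> 0`. For `a ∈ A` with `a ≥ x₀` and any `b ∈ B`, the sum `a + b` has no prime factor in `U`. So for
`p ∈ U` the classes modulo `p` of the large elements of `A` avoid the negatives of the classes of
`B`: the more classes `B` occupies, the stronger a sieve acts on `A`. The proof bootstraps this,
using that `A(x) B(x)` is essentially at least the counting function of `𝒬(T)`. Write `V = ∑ 1/p`
over `p ≤ x` in `U`.

1. If `r` elements of `B` are fixed, an upper bound sieve gives `A(x) ≪ x exp(-rV)`, while `𝒬(T)`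
has `≫ x exp(-V)` elements up to `x`. With `r ≥ 2` this rules out a finite `B`; with `r` arbitrary
it makes `B(x)` exceed every power of `log x` (`infinite_right`, `eventually_log_pow_le`).

2. If `B(x) ≥ y`, Gallagher's larger sieve shows that `B` meets many classes modulo the primes `p ≈
y` of `U`: the sum of `residueCount B p / p` is `≫ y / (log x)^2`. The large sieve for `A` with
moduli the products of `m` such primes, `y^(2m) ≤ x`, then bounds `A(x)` (`exists_card_mul_pow_le`).

3. Taking `y = (log x)^16` gives `A(x) ≪ x^(5/8) (log x)^12`, hence `B(x) ≥ x^(1/4)`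
(`exists_card_le_rpow`, `eventually_rpow_le`). Taking `y = x^(1/4)` and `m = 2` gives `A(x) ≪
x^(1/2) (log x)^4`. The roles of `A` and `B` are symmetric. -/

/-! ### Additive characters and the analytic large sieve -/

/-- The additive character `x ↦ exp (2πix)` of `ℝ`. -/
noncomputable def expChar (x : ℝ) : ℂ := Complex.exp (2 * Real.pi * x * Complex.I)

lemma expChar_add (x y : ℝ) : expChar (x + y) = expChar x * expChar y := by
  rw [expChar, expChar, expChar, ← Complex.exp_add]
  congr 1; push_cast; ring

lemma expChar_intCast (k : ℤ) : expChar k = 1 := by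
  rw [expChar, Complex.exp_eq_one_iff]
  exact ⟨k, by push_cast; ring⟩

lemma expChar_natCast (k : ℕ) : expChar k = 1 := by
  simpa using expChar_intCast k

lemma expChar_nat_mul (n : ℕ) (x : ℝ) : expChar (n * x) = expChar x ^ n := by
  rw [expChar, expChar, ← Complex.exp_nat_mul]
  congr 1; push_cast; ring

lemma expChar_neg (x : ℝ) : expChar (-x) = (starRingEnd ℂ) (expChar x) := by
  rw [expChar, expChar, ← Complex.exp_conj]
  congr 1
  simp [Complex.conj_ofNat]

lemma expChar_eq_one_iff (x : ℝ) : expChar x = 1 ↔ ∃ k : ℤ, x = k := by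
  constructor
  · intro h
    rw [expChar, Complex.exp_eq_one_iff] at h
    obtain ⟨k, hk⟩ := h
    refine ⟨k, ?_⟩
    have h2 : (2 * Real.pi * Complex.I : ℂ) ≠ 0 := Complex.two_pi_I_ne_zero
    have : (x : ℂ) = (k : ℂ) := by
      apply mul_right_cancel₀ h2
      rw [← hk]; ring
    exact_mod_cast this
  · rintro ⟨k, rfl⟩
    exact expChar_intCast k

lemma sum_expChar_eq_zero {M : ℕ} {n m : ℕ} (hn : n < M) (hm : m < M) (hnm : n ≠ m) :
    ∑ j ∈ Finset.range M, expChar (n * (j / M)) * expChar (-(m * (j / M))) = 0 := by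
  have hM : (M : ℝ) ≠ 0 := by
    have : 0 < M := by omega
    positivity
  set x : ℝ := ((n : ℝ) - m) / M with hx
  have h1 : ∀ j : ℕ, expChar (n * (j / M)) * expChar (-(m * (j / M))) = expChar x ^ j := by
    intro j
    rw [← expChar_add, ← expChar_nat_mul]
    congr 1
    rw [hx]; field_simp; ring
  simp_rw [h1]
  have hne : expChar x ≠ 1 := by
    intro h
    obtain ⟨k, hk⟩ := (expChar_eq_one_iff x).1 h
    have h2 : (n : ℝ) - m = k * M := by
      rw [hx] at hk; field_simp at hk; linarith
    have h3 : (n : ℤ) - m = k * M := by exact_mod_cast h2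
    have h4 : (M : ℤ) ∣ (n : ℤ) - m := ⟨k, by rw [h3]; ring⟩
    have h5 : (n : ℤ) - m = 0 := by
      apply Int.eq_zero_of_abs_lt_dvd h4
      rw [abs_lt]; constructor <;> omega
    omega
  rw [geom_sum_eq hne]
  have : expChar x ^ M = 1 := by
    rw [← expChar_nat_mul, expChar_eq_one_iff]
    exact ⟨(n : ℤ) - m, by rw [hx]; push_cast; field_simp⟩
  rw [this]; simp

/-- Parseval's identity on `ℤ / M`. -/
lemma parseval (M : ℕ) (c : ℕ → ℂ) :
    ∑ j ∈ Finset.range M, ‖∑ n ∈ Finset.range M, c n * expChar (n * (j / M))‖ ^ 2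
      = M * ∑ n ∈ Finset.range M, ‖c n‖ ^ 2 := by
  have key : ((∑ j ∈ Finset.range M, ‖∑ n ∈ Finset.range M, c n * expChar (n * (j / M))‖ ^ 2 : ℝ) : ℂ)
      = ((M * ∑ n ∈ Finset.range M, ‖c n‖ ^ 2 : ℝ) : ℂ) := by
    push_cast
    simp_rw [← Complex.mul_conj', map_sum, map_mul, ← expChar_neg, Finset.sum_mul_sum]
    rw [Finset.sum_comm]
    rw [Finset.mul_sum]
    refine Finset.sum_congr rfl fun n hn => ?_
    rw [Finset.sum_comm]
    rw [Finset.sum_eq_single n]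
    · have : ∀ j : ℕ, c n * expChar (n * (j / M)) * ((starRingEnd ℂ) (c n) * expChar (-(n * (j / M))))
          = c n * (starRingEnd ℂ) (c n) := by
        intro j
        have : expChar (n * (j / M)) * expChar (-(n * (j / M))) = 1 := by
          rw [← expChar_add]; simp [expChar]
        linear_combination (c n * (starRingEnd ℂ) (c n)) * this
      simp [this]
    · intro m hm hmn
      have := sum_expChar_eq_zero (Finset.mem_range.1 hn) (Finset.mem_range.1 hm) hmn.symm
      have h2 : ∀ j : ℕ, c n * expChar (n * (j / M)) * ((starRingEnd ℂ) (c m) * expChar (-(m * (j / M))))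
          = (c n * (starRingEnd ℂ) (c m)) * (expChar (n * (j / M)) * expChar (-(m * (j / M)))) := by
        intro j; ring
      simp_rw [h2]
      rw [← Finset.mul_sum, this, mul_zero]
    · intro h; exact absurd hn h
  exact_mod_cast key

/-- The points `j r / M` with `j r` distinct modulo `M`: an upper bound from Parseval's identity. -/
lemma sum_sq_le_of_incongruent {ι : Type*} (I : Finset ι) (M : ℕ) (hM : 0 < M) (j : ι → ℤ)
    (hj : ∀ r ∈ I, ∀ s ∈ I, (M : ℤ) ∣ j r - j s → r = s) (c : ℕ → ℂ) :
    ∑ r ∈ I, ‖∑ n ∈ Finset.range M, c n * expChar (n * (j r / M))‖ ^ 2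
      ≤ M * ∑ n ∈ Finset.range M, ‖c n‖ ^ 2 := by
  have hMz : (M : ℤ) ≠ 0 := by positivity
  have hMr : (M : ℝ) ≠ 0 := by positivity
  rw [← parseval]
  set g : ι → ℕ := fun r => (j r % M).toNat with hg
  have hgc : ∀ r, ((g r : ℕ) : ℤ) = j r % M := fun r =>
    Int.toNat_of_nonneg (Int.emod_nonneg _ hMz)
  have heq : ∀ r ∈ I, ‖∑ n ∈ Finset.range M, c n * expChar (n * (j r / M))‖ ^ 2
      = ‖∑ n ∈ Finset.range M, c n * expChar (n * ((g r : ℕ) / M))‖ ^ 2 := by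
    intro r _
    congr 2
    refine Finset.sum_congr rfl fun n _ => ?_
    congr 1
    have h1 : (j r : ℝ) = (g r : ℝ) + M * ((j r / (M : ℤ) : ℤ) : ℝ) := by
      have h2 : j r = (g r : ℤ) + M * (j r / (M : ℤ)) := by
        rw [hgc]; exact (Int.emod_add_mul_ediv _ _).symm
      exact_mod_cast h2
    have h2 : (n : ℝ) * (j r / M) = n * ((g r : ℕ) / M) + ((n * (j r / (M : ℤ)) : ℤ) : ℝ) := by
      rw [h1]; push_cast; field_simp
    rw [h2, expChar_add, expChar_intCast, mul_one]
  rw [Finset.sum_congr rfl heq]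
  have hinj : Set.InjOn g I := by
    intro r hr s hs hrs
    apply hj r hr s hs
    have : j r % M = j s % M := by rw [← hgc, ← hgc, hrs]
    exact Int.ModEq.dvd (Eq.symm this)
  rw [← Finset.sum_image (f := fun k : ℕ => ‖∑ n ∈ Finset.range M, c n * expChar (n * ((k : ℕ) / M))‖ ^ 2) hinj]
  apply Finset.sum_le_sum_of_subset_of_nonneg
  · intro k hk
    obtain ⟨r, _, rfl⟩ := Finset.mem_image.1 hk
    rw [Finset.mem_range]
    have := Int.emod_lt_of_pos (j r) (by positivity : (0 : ℤ) < M)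
    have := hgc r
    omega
  · intros; positivity

/-- The analytic large sieve inequality, for points with mutual distance at least `1 / M`
modulo `1`. -/
lemma large_sieve {ι : Type*} (I : Finset ι) (M : ℕ) (hM : 0 < M) (α : ι → ℝ)
    (hα : ∀ r ∈ I, ∀ s ∈ I, r ≠ s → ∀ k : ℤ, 1 / (M : ℝ) ≤ |α r - α s - k|) (c : ℕ → ℂ) :
    ∑ r ∈ I, ‖∑ n ∈ Finset.range M, c n * expChar (n * α r)‖ ^ 2
      ≤ Real.exp (4 * Real.pi) * (M * ∑ n ∈ Finset.range M, ‖c n‖ ^ 2) := by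
  have hMr : (0 : ℝ) < M := by positivity
  -- Write `α r = (j r + f r) / M` with `0 ≤ f r < 1`. The spacing makes the `j r` incongruent
  -- modulo `M`, so Parseval applies at the points `j r / M`. The remaining phase is expanded in
  -- powers of `f r`: the `k`-th term costs `(2π)^k / k!`, and the sum `exp(2π)` is squared at the
  -- end.
  set j : ι → ℤ := fun r => ⌊M * α r⌋ with hj
  set f : ι → ℝ := fun r => Int.fract (M * α r) with hf
  have hdecomp : ∀ r, α r = j r / M + f r / M := by
    intro r
    change α r = (⌊M * α r⌋ : ℝ) / M + Int.fract (M * α r) / M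
    rw [← add_div, Int.floor_add_fract]; field_simp
  have hinc : ∀ r ∈ I, ∀ s ∈ I, (M : ℤ) ∣ j r - j s → r = s := by
    intro r hr s hs ⟨k, hk⟩
    by_contra hne
    have h1 := hα r hr s hs hne k
    have hk' : (j r : ℝ) - j s = M * k := by exact_mod_cast hk
    have h2 : α r - α s - k = (f r - f s) / M := by
      rw [hdecomp r, hdecomp s]; field_simp; linarith
    rw [h2, abs_div, abs_of_pos hMr, div_le_div_iff_of_pos_right hMr] at h1
    have h3 : |f r - f s| < 1 := by
      have := Int.fract_nonneg (M * α r)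
      have := Int.fract_lt_one (M * α r)
      have := Int.fract_nonneg (M * α s)
      have := Int.fract_lt_one (M * α s)
      rw [abs_lt]; simp only [hf]; constructor <;> linarith
    linarith
  set B : ℝ := M * ∑ n ∈ Finset.range M, ‖c n‖ ^ 2 with hB
  have hB0 : 0 ≤ B := by positivity
  -- the Taylor coefficients in `f r`, as vectors indexed by `r ∈ I`
  let v : ℕ → EuclideanSpace ℂ I := fun k => WithLp.toLp 2 fun r =>
    ((f r : ℂ) * (2 * Real.pi * Complex.I)) ^ k / (k.factorial : ℂ) *
      ∑ n ∈ Finset.range M, (c n * ((n : ℂ) / M) ^ k) * expChar (n * (j r / M))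
  have hv : ∀ k, ‖v k‖ ≤ (2 * Real.pi) ^ k / k.factorial * Real.sqrt B := by
    intro k
    rw [EuclideanSpace.norm_eq]
    have h0 : (0 : ℝ) ≤ (2 * Real.pi) ^ k / k.factorial := by positivity
    rw [← Real.sqrt_sq h0, ← Real.sqrt_mul (sq_nonneg _)]
    apply Real.sqrt_le_sqrt
    have h1 : ∀ r : I, ‖(v k) r‖ ^ 2 ≤ ((2 * Real.pi) ^ k / k.factorial) ^ 2 *
        ‖∑ n ∈ Finset.range M, (c n * ((n : ℂ) / M) ^ k) * expChar (n * (j r / M))‖ ^ 2 := by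
      intro r
      change ‖_ * _‖ ^ 2 ≤ _
      rw [norm_mul, mul_pow]
      gcongr
      rw [norm_div, norm_pow, norm_mul, norm_mul, norm_mul]
      simp only [Complex.norm_real, Complex.norm_I, mul_one, Complex.norm_natCast]
      have h5 : ‖(2 : ℂ)‖ = 2 := by simp
      have h6 : ‖f r‖ * (‖(2 : ℂ)‖ * ‖Real.pi‖) ≤ 2 * Real.pi := by
        rw [Real.norm_of_nonneg (Int.fract_nonneg _), Real.norm_of_nonneg Real.pi_pos.le, h5]
        exact mul_le_of_le_one_left (by positivity) (Int.fract_lt_one _).le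
      exact div_le_div_of_nonneg_right (pow_le_pow_left₀ (by positivity) h6 k) (by positivity)
    refine (Finset.sum_le_sum fun r _ => h1 r).trans ?_
    rw [← Finset.mul_sum]
    gcongr
    have h2 := sum_sq_le_of_incongruent I M hM j hinc (fun n => c n * ((n : ℂ) / M) ^ k)
    rw [Finset.sum_coe_sort I (fun r => ‖∑ n ∈ Finset.range M, (c n * ((n : ℂ) / M) ^ k) *
      expChar (n * (j r / M))‖ ^ 2)]
    refine h2.trans ?_
    rw [hB]
    gcongr with n hn
    rw [norm_mul, norm_pow]
    have : ‖((n : ℂ) / M)‖ ≤ 1 := by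
      rw [norm_div, Complex.norm_natCast, Complex.norm_natCast, div_le_one hMr]
      exact_mod_cast (Finset.mem_range.1 hn).le
    exact mul_le_of_le_one_right (norm_nonneg _) (pow_le_one₀ (norm_nonneg _) this)
  have hsum : HasSum (fun k : ℕ => (2 * Real.pi) ^ k / k.factorial * Real.sqrt B)
      (Real.exp (2 * Real.pi) * Real.sqrt B) := by
    apply HasSum.mul_right
    have := NormedSpace.expSeries_div_hasSum_exp (2 * Real.pi)
    rwa [← Real.exp_eq_exp_ℝ] at this
  have hnorm := tsum_of_norm_bounded hsum hv
  have hsummable : Summable v := Summable.of_norm_bounded hsum.summable hv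
  have hval : ∀ r : I, (∑' k, v k) r = ∑ n ∈ Finset.range M, c n * expChar (n * α r) := by
    intro r
    have h1 : HasSum (fun k => (v k) r) ((∑' k, v k) r) :=
      hsummable.hasSum.mapL (EuclideanSpace.proj r : EuclideanSpace ℂ I →L[ℂ] ℂ)
    have h2 : HasSum (fun k => (v k) r) (∑ n ∈ Finset.range M, c n * expChar (n * α r)) := by
      have h3 : ∀ k, (v k) r = ∑ n ∈ Finset.range M, (c n * expChar (n * (j r / M))) *
          ((2 * Real.pi * (n * (f r / M) : ℝ) * Complex.I : ℂ) ^ k / k.factorial) := by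
        intro k
        change _ * _ = _
        rw [Finset.mul_sum]
        refine Finset.sum_congr rfl fun n _ => ?_
        push_cast
        ring
      simp_rw [h3]
      apply hasSum_sum
      intro n _
      have h4 : c n * expChar (n * α r) = (c n * expChar (n * (j r / M))) *
          expChar (n * (f r / M)) := by
        rw [mul_assoc, ← expChar_add, ← mul_add, ← hdecomp]
      rw [h4]
      apply HasSum.mul_left
      rw [expChar, Complex.exp_eq_exp_ℂ]
      exact NormedSpace.expSeries_div_hasSum_exp _
    exact h1.unique h2
  have hfin : ∑ r ∈ I, ‖∑ n ∈ Finset.range M, c n * expChar (n * α r)‖ ^ 2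
      = ‖∑' k, v k‖ ^ 2 := by
    rw [EuclideanSpace.norm_sq_eq]
    simp_rw [hval]
    rw [Finset.sum_coe_sort I (fun r => ‖∑ n ∈ Finset.range M, c n * expChar (n * α r)‖ ^ 2)]
  rw [hfin]
  calc ‖∑' k, v k‖ ^ 2 ≤ (Real.exp (2 * Real.pi) * Real.sqrt B) ^ 2 := by gcongr
    _ = Real.exp (4 * Real.pi) * B := by
      rw [mul_pow, Real.sq_sqrt hB0, ← Real.exp_nat_mul]
      congr 2; push_cast; ring

/-! ### The arithmetic large sieve and its form for sumsets -/

/-- The number of residue classes modulo `p` that are met by `A`. -/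
def residueCount (A : Finset ℕ) (p : ℕ) : ℕ := (A.image (· % p)).card

/-- The exponential sum over a finite set `A`. -/
noncomputable def expSum (A : Finset ℕ) (β : ℝ) : ℂ := ∑ n ∈ A, expChar (n * β)

/-- Grouped by `n % p`, the shifted sum is a Fourier transform on `ℤ / p` of the partial sums over
residue classes, so this is Parseval. -/
lemma sum_norm_expSum_sq_add_div (A : Finset ℕ) {p : ℕ} (hp : 0 < p) (β : ℝ) :
    ∑ a ∈ Finset.range p, ‖expSum A (β + a / p)‖ ^ 2
      = p * ∑ h ∈ Finset.range p, ‖∑ n ∈ A with n % p = h, expChar (n * β)‖ ^ 2 := by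
  rw [← parseval]
  refine Finset.sum_congr rfl fun a _ => ?_
  congr 2
  rw [expSum, ← Finset.sum_fiberwise_of_maps_to (t := Finset.range p) (g := (· % p))
    (fun n _ => Finset.mem_range.2 (Nat.mod_lt _ hp))]
  refine Finset.sum_congr rfl fun h _ => ?_
  rw [Finset.sum_mul]
  refine Finset.sum_congr rfl fun n hn => ?_
  have hn2 := (Finset.mem_filter.1 hn).2
  have hpr : (p : ℝ) ≠ 0 := by positivity
  have h1 : (n : ℝ) * (β + a / p) = n * β + h * (a / p) + ((n / p * a : ℕ) : ℝ) := by
    have h2 : (n : ℝ) = h + p * (n / p : ℕ) := by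
      rw [← hn2]; exact_mod_cast (Nat.mod_add_div n p).symm
    have h3 : (n : ℝ) * (β + a / p) = n * β + n * (a / p) := by ring
    rw [h3]
    nth_rewrite 2 [h2]
    push_cast; field_simp; ring
  rw [h1, expChar_add, expChar_add, expChar_natCast, mul_one]

/-- Cauchy–Schwarz over the classes that `A` meets; the empty ones contribute nothing, which is why
the factor is smaller than `p`. -/
lemma norm_expSum_sq_le (A : Finset ℕ) {p : ℕ} (hp : 0 < p) (β : ℝ) :
    ‖expSum A β‖ ^ 2 ≤ residueCount A p *
      ∑ h ∈ Finset.range p, ‖∑ n ∈ A with n % p = h, expChar (n * β)‖ ^ 2 := by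
  have h1 : expSum A β = ∑ h ∈ A.image (· % p), ∑ n ∈ A with n % p = h, expChar (n * β) := by
    rw [expSum, Finset.sum_fiberwise_of_maps_to]
    intro n hn
    exact Finset.mem_image_of_mem _ hn
  have h2 : ‖expSum A β‖ ≤ ∑ h ∈ A.image (· % p), ‖∑ n ∈ A with n % p = h, expChar (n * β)‖ := by
    rw [h1]; exact norm_sum_le _ _
  calc ‖expSum A β‖ ^ 2 ≤ (∑ h ∈ A.image (· % p), ‖∑ n ∈ A with n % p = h, expChar (n * β)‖) ^ 2 := by
        gcongr
    _ ≤ residueCount A p *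
      ∑ h ∈ A.image (· % p), ‖∑ n ∈ A with n % p = h, expChar (n * β)‖ ^ 2 :=
        sq_sum_le_card_mul_sum_sq
    _ ≤ _ := by
      gcongr
      intro h hh
      obtain ⟨n, _, rfl⟩ := Finset.mem_image.1 hh
      exact Finset.mem_range.2 (Nat.mod_lt _ hp)

/-- The sum over all `a` modulo `p` is at least `1 + w` times its own term at `a = 0`; dropping that
term leaves the factor `w`. -/
lemma mul_norm_expSum_sq_le (A : Finset ℕ) {p : ℕ} (hp : 0 < p) {w : ℝ} (hw : 0 ≤ w)
    (h : (1 + w) * residueCount A p ≤ p) (β : ℝ) :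
    w * ‖expSum A β‖ ^ 2 ≤ ∑ a ∈ Finset.Ico 1 p, ‖expSum A (β + a / p)‖ ^ 2 := by
  have h1 := sum_norm_expSum_sq_add_div A hp β
  rw [Finset.range_eq_Ico, Finset.sum_eq_sum_Ico_succ_bot hp, ← Finset.range_eq_Ico] at h1
  simp only [Nat.cast_zero, zero_div, add_zero, zero_add] at h1
  have h2 := norm_expSum_sq_le A hp β
  set Z := ∑ h ∈ Finset.range p, ‖∑ n ∈ A with n % p = h, expChar (n * β)‖ ^ 2
  have hZ : 0 ≤ Z := by positivity
  have h3 : (1 + w) * ‖expSum A β‖ ^ 2 ≤ p * Z := by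
    calc _ ≤ (1 + w) * (residueCount A p * Z) := by gcongr
      _ = ((1 + w) * residueCount A p) * Z := by ring
      _ ≤ p * Z := by gcongr
  linarith

/-- Montgomery's inequality: for a set `s` of primes, the exponential sum at `β` is controlled by
those at `β + ∑ a_p / p`, with `a_p` prime to `p` for every `p ∈ s`. -/
lemma exists_freqs (A : Finset ℕ) (w : ℕ → ℝ) (hw : ∀ p, 0 ≤ w p) (s : Finset ℕ)
    (hs : ∀ p ∈ s, 0 < p ∧ (1 + w p) * residueCount A p ≤ p) :
    ∃ F : Finset (ℕ → ℕ), (∀ a ∈ F, (∀ p ∉ s, a p = 0) ∧ ∀ p ∈ s, 0 < a p ∧ a p < p) ∧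
      ∀ β : ℝ, (∏ p ∈ s, w p) * ‖expSum A β‖ ^ 2
        ≤ ∑ a ∈ F, ‖expSum A (β + ∑ p ∈ s, (a p : ℝ) / p)‖ ^ 2 := by
  classical
  induction s using Finset.induction_on with
  | empty => exact ⟨{fun _ => 0}, by simp, by simp⟩
  | insert p s hps ih =>
    obtain ⟨F, hF, hF2⟩ := ih fun q hq => hs q (Finset.mem_insert_of_mem hq)
    obtain ⟨hp0, hp⟩ := hs p (Finset.mem_insert_self _ _)
    refine ⟨(Finset.Ico 1 p ×ˢ F).image fun x => Function.update x.2 p x.1, ?_, ?_⟩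
    · intro a ha
      obtain ⟨⟨k, a⟩, hka, rfl⟩ := Finset.mem_image.1 ha
      obtain ⟨hk, ha⟩ := Finset.mem_product.1 hka
      have hk := Finset.mem_Ico.1 hk
      obtain ⟨h1, h2⟩ := hF a ha
      constructor
      · intro q hq
        rw [Finset.mem_insert, not_or] at hq
        rw [Function.update_of_ne hq.1]
        exact h1 q hq.2
      · intro q hq
        rcases eq_or_ne q p with rfl | hqp
        · simp only [Function.update_self]; exact hk
        · rw [Function.update_of_ne hqp]
          exact h2 q ((Finset.mem_insert.1 hq).resolve_left hqp)
    -- The one-prime inequality is applied at `β`, then the induction hypothesis at each shift `β +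
    -- k / p`.
    · intro β
      rw [Finset.sum_image]
      · rw [Finset.sum_product, Finset.prod_insert hps]
        calc w p * (∏ p ∈ s, w p) * ‖expSum A β‖ ^ 2
            = (∏ p ∈ s, w p) * (w p * ‖expSum A β‖ ^ 2) := by ring
          _ ≤ (∏ p ∈ s, w p) * ∑ k ∈ Finset.Ico 1 p, ‖expSum A (β + k / p)‖ ^ 2 := by
            have := Finset.prod_nonneg fun q (_ : q ∈ s) => hw q
            gcongr
            exact mul_norm_expSum_sq_le A hp0 (hw p) hp β
          _ = ∑ k ∈ Finset.Ico 1 p, (∏ p ∈ s, w p) * ‖expSum A (β + k / p)‖ ^ 2 := Finset.mul_sum ..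
          _ ≤ _ := by
            refine Finset.sum_le_sum fun k _ => (hF2 _).trans_eq ?_
            refine Finset.sum_congr rfl fun a _ => ?_
            rw [Finset.sum_insert hps, Function.update_self, ← add_assoc]
            congr 4
            refine Finset.sum_congr rfl fun q hq => ?_
            rw [Function.update_of_ne]
            rintro rfl; exact hps hq
      · rintro ⟨k, a⟩ hka ⟨l, b⟩ hlb hab
        have ha := (Finset.mem_product.1 (Finset.mem_coe.1 hka)).2
        have hb := (Finset.mem_product.1 (Finset.mem_coe.1 hlb)).2
        simp only at hab ha hb
        have h1 : k = l := by simpa using congrFun hab p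
        have h2 : a = b := by
          funext q
          rcases eq_or_ne q p with rfl | hqp
          · rw [(hF a ha).1 q hps, (hF b hb).1 q hps]
          · simpa [Function.update_of_ne hqp] using congrFun hab q
        rw [h1, h2]

lemma exists_int_eq_prod_mul_sum (s t : Finset ℕ) (hst : s ⊆ t) (ht : ∀ p ∈ t, 0 < p) (a : ℕ → ℕ) :
    ∃ k : ℤ, ((∏ p ∈ t, p : ℕ) : ℝ) * ∑ p ∈ s, (a p : ℝ) / p = k := by
  classical
  refine ⟨∑ p ∈ s, ((∏ q ∈ t.erase p, q : ℕ) : ℤ) * a p, ?_⟩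
  rw [Finset.mul_sum]
  push_cast
  refine Finset.sum_congr rfl fun p hp => ?_
  rw [← Finset.mul_prod_erase t _ (hst hp)]
  have : (p : ℝ) ≠ 0 := by have := ht p (hst hp); positivity
  field_simp

/-- Sums `∑ a_p / p` with distinct numerators are incongruent modulo `1`. -/
lemma eq_of_sum_div_sub_eq_int (P : Finset ℕ) (hP : ∀ p ∈ P, p.Prime) (a b : ℕ → ℕ)
    (ha : ∀ p ∈ P, a p < p) (hb : ∀ p ∈ P, b p < p) (k : ℤ)
    (h : ∑ p ∈ P, (a p : ℝ) / p - ∑ p ∈ P, (b p : ℝ) / p = k) : ∀ p ∈ P, a p = b p := by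
  classical
  intro p hp
  set D : ℕ := ∏ q ∈ P.erase p, q with hD
  have hPe : ∀ q ∈ P.erase p, 0 < q := fun q hq => (hP q (Finset.mem_of_mem_erase hq)).pos
  obtain ⟨k1, hk1⟩ := exists_int_eq_prod_mul_sum (P.erase p) _ subset_rfl hPe a
  obtain ⟨k2, hk2⟩ := exists_int_eq_prod_mul_sum (P.erase p) _ subset_rfl hPe b
  rw [← Finset.add_sum_erase P _ hp, ← Finset.add_sum_erase P _ hp] at h
  have hp0 : (p : ℝ) ≠ 0 := by have := (hP p hp).pos; positivity
  -- Clearing denominators leaves `p` dividing `D * (a p - b p)`, with `D` prime to `p`.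
  have h1 : (D : ℝ) * (a p - b p) = p * (D * k - k1 + k2) := by
    rw [← hk1, ← hk2, ← h]; field_simp; ring
  have h2 : (D : ℤ) * (a p - b p) = p * (D * k - k1 + k2) := by exact_mod_cast h1
  have h3 : (p : ℤ) ∣ (D : ℤ) * (a p - b p) := ⟨_, h2⟩
  have hcop : IsCoprime (p : ℤ) (D : ℤ) := by
    rw [Nat.isCoprime_iff_coprime]
    apply Nat.Coprime.prod_right
    intro q hq
    exact (Nat.coprime_primes (hP p hp) (hP q (Finset.mem_of_mem_erase hq))).2
      (Finset.ne_of_mem_erase hq).symm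
  have h4 := hcop.dvd_of_dvd_mul_left h3
  have h5 : (a p : ℤ) - b p = 0 := by
    apply Int.eq_zero_of_abs_lt_dvd h4
    have := ha p hp
    have := hb p hp
    rw [abs_lt]; constructor <;> omega
  omega

/-- The arithmetic large sieve, over squarefree moduli given by their sets of prime factors. -/
theorem arithmetic_large_sieve (A : Finset ℕ) (M : ℕ) (hA : ∀ n ∈ A, n < M) (w : ℕ → ℝ)
    (hw : ∀ p, 0 ≤ w p) (𝒮 : Finset (Finset ℕ))
    (h𝒮 : ∀ s ∈ 𝒮, ∀ p ∈ s, p.Prime ∧ (1 + w p) * residueCount A p ≤ p)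
    (hsize : ∀ s ∈ 𝒮, (∏ p ∈ s, p) ^ 2 ≤ M) :
    A.card * ∑ s ∈ 𝒮, ∏ p ∈ s, w p ≤ Real.exp (4 * Real.pi) * M := by
  classical
  rcases A.eq_empty_or_nonempty with rfl | ⟨n0, hn0⟩
  · simp; positivity
  have hM : 0 < M := (Nat.zero_le _).trans_lt (hA n0 hn0)
  have hMr : (0 : ℝ) < M := by positivity
  have hex : ∀ s : Finset ℕ, ∃ F : Finset (ℕ → ℕ), s ∈ 𝒮 →
      (∀ a ∈ F, (∀ p ∉ s, a p = 0) ∧ ∀ p ∈ s, 0 < a p ∧ a p < p) ∧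
      ∀ β : ℝ, (∏ p ∈ s, w p) * ‖expSum A β‖ ^ 2
        ≤ ∑ a ∈ F, ‖expSum A (β + ∑ p ∈ s, (a p : ℝ) / p)‖ ^ 2 := by
    intro s
    by_cases hs : s ∈ 𝒮
    · obtain ⟨F, hF⟩ := exists_freqs A w hw s fun p hp =>
        ⟨(h𝒮 s hs p hp).1.pos, (h𝒮 s hs p hp).2⟩
      exact ⟨F, fun _ => hF⟩
    · exact ⟨∅, fun h => absurd h hs⟩
  choose F hF using hex
  set P : Finset ℕ := 𝒮.biUnion id with hPdef
  have hP : ∀ p ∈ P, p.Prime := by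
    intro p hp
    obtain ⟨s, hs, hps⟩ := Finset.mem_biUnion.1 hp
    exact (h𝒮 s hs p hps).1
  have hsub : ∀ s ∈ 𝒮, s ⊆ P := fun s hs => Finset.subset_biUnion_of_mem id hs
  have hlt : ∀ s ∈ 𝒮, ∀ a ∈ F s, ∀ p ∈ P, a p < p := by
    intro s hs a ha p hp
    by_cases hps : p ∈ s
    · exact (((hF s hs).1 a ha).2 p hps).2
    · rw [((hF s hs).1 a ha).1 p hps]; exact (hP p hp).pos
  have hsumP : ∀ s ∈ 𝒮, ∀ a ∈ F s, ∑ p ∈ s, (a p : ℝ) / p = ∑ p ∈ P, (a p : ℝ) / p := by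
    intro s hs a ha
    apply Finset.sum_subset (hsub s hs)
    intro p _ hps
    rw [((hF s hs).1 a ha).1 p hps]; simp
  -- The support of a numerator vector recovers its modulus, so the families `F s` are disjoint.
  have hsupp : ∀ s ∈ 𝒮, ∀ t ∈ 𝒮, ∀ a, a ∈ F s → a ∈ F t → s ⊆ t := by
    intro s hs t ht a has hat p hps
    by_contra hpt
    have h1 := (((hF s hs).1 a has).2 p hps).1
    rw [((hF t ht).1 a hat).1 p hpt] at h1
    exact lt_irrefl _ h1
  have hdisj : (𝒮 : Set (Finset ℕ)).PairwiseDisjoint F := by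
    intro s hs t ht hst
    rw [Function.onFun, Finset.disjoint_left]
    intro a has hat
    exact hst ((hsupp s hs t ht a has hat).antisymm (hsupp t ht s hs a hat has))
  have hls := large_sieve (𝒮.biUnion F) M hM (fun a => ∑ p ∈ P, (a p : ℝ) / p) (by
    intro a ha b hb hab k
    obtain ⟨s, hs, has⟩ := Finset.mem_biUnion.1 ha
    obtain ⟨t, ht, hbt⟩ := Finset.mem_biUnion.1 hb
    by_contra hlt'
    push Not at hlt'
    set x : ℝ := ∑ p ∈ P, (a p : ℝ) / p - ∑ p ∈ P, (b p : ℝ) / p - k with hx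
    set q : ℕ := ∏ p ∈ s, p with hq
    set q' : ℕ := ∏ p ∈ t, p with hq'
    obtain ⟨k1, hk1⟩ := exists_int_eq_prod_mul_sum s s subset_rfl
      (fun p hp => (hP p (hsub s hs hp)).pos) a
    obtain ⟨k2, hk2⟩ := exists_int_eq_prod_mul_sum t t subset_rfl
      (fun p hp => (hP p (hsub t ht hp)).pos) b
    rw [hsumP s hs a has] at hk1
    rw [hsumP t ht b hbt] at hk2
    -- Fractions with denominators `q` and `q'` differ modulo `1` by a multiple of `1 / (q q')`, and
    -- `q q' ≤ M`; a distance below `1 / M` is therefore zero.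
    have hqq : q * q' ≤ M := by
      have h1 := hsize s hs
      have h2 := hsize t ht
      nlinarith [sq_nonneg ((q : ℤ) - q')]
    have hint : (q * q' : ℝ) * x = ((q' * k1 - q * k2 - q * q' * k : ℤ) : ℝ) := by
      push_cast; rw [← hk1, ← hk2, hx]; ring
    have habs : |(q * q' : ℝ) * x| < 1 := by
      rw [abs_mul, abs_of_nonneg (by positivity)]
      have h1 : (q * q' : ℝ) ≤ M := by exact_mod_cast hqq
      calc (q * q' : ℝ) * |x| ≤ M * |x| := by gcongr
        _ < M * (1 / M) := by gcongr
        _ = 1 := by field_simp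
    rw [hint] at habs
    have h0 : (q' * k1 - q * k2 - q * q' * k : ℤ) = 0 := by
      have : |(q' * k1 - q * k2 - q * q' * k : ℤ)| < 1 := by exact_mod_cast habs
      exact Int.abs_lt_one_iff.1 this
    rw [h0] at hint
    have hq0 : (q : ℝ) ≠ 0 := by
      have : q ≠ 0 := Finset.prod_ne_zero_iff.2 fun p hp => (hP p (hsub s hs hp)).ne_zero
      exact_mod_cast this
    have hq0' : (q' : ℝ) ≠ 0 := by
      have : q' ≠ 0 := Finset.prod_ne_zero_iff.2 fun p hp => (hP p (hsub t ht hp)).ne_zero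
      exact_mod_cast this
    have hx0 : x = 0 := by
      simpa [hq0, hq0'] using hint
    apply hab
    have hk : ∑ p ∈ P, (a p : ℝ) / p - ∑ p ∈ P, (b p : ℝ) / p = k := by linarith
    have heq := eq_of_sum_div_sub_eq_int P hP a b (hlt s hs a has) (hlt t ht b hbt) k hk
    funext p
    by_cases hp : p ∈ P
    · exact heq p hp
    · rw [((hF s hs).1 a has).1 p fun h => hp (hsub s hs h),
        ((hF t ht).1 b hbt).1 p fun h => hp (hsub t ht h)]) (fun n => if n ∈ A then 1 else 0)
  have hAM : Finset.filter (· ∈ A) (Finset.range M) = A := by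
    ext n; simp only [Finset.mem_filter, Finset.mem_range]
    exact ⟨fun h => h.2, fun h => ⟨hA n h, h⟩⟩
  have hexp : ∀ β, ∑ n ∈ Finset.range M, (if n ∈ A then (1 : ℂ) else 0) * expChar (n * β)
      = expSum A β := by
    intro β
    simp_rw [ite_mul, one_mul, zero_mul]
    rw [← Finset.sum_filter, hAM, expSum]
  have hcard : ∑ n ∈ Finset.range M, ‖(if n ∈ A then (1 : ℂ) else 0)‖ ^ 2 = A.card := by
    have : ∀ n, ‖(if n ∈ A then (1 : ℂ) else 0)‖ ^ 2 = if n ∈ A then (1 : ℝ) else 0 := by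
      intro n; split_ifs <;> simp
    simp_rw [this]
    rw [← Finset.sum_filter, hAM]; simp
  simp_rw [hexp] at hls
  rw [hcard, Finset.sum_biUnion hdisj] at hls
  have hlow : (∑ s ∈ 𝒮, ∏ p ∈ s, w p) * (A.card : ℝ) ^ 2
      ≤ ∑ s ∈ 𝒮, ∑ a ∈ F s, ‖expSum A (∑ p ∈ P, (a p : ℝ) / p)‖ ^ 2 := by
    rw [Finset.sum_mul]
    refine Finset.sum_le_sum fun s hs => ?_
    have h1 := (hF s hs).2 0
    have h2 : ‖expSum A 0‖ ^ 2 = (A.card : ℝ) ^ 2 := by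
      have : expSum A 0 = A.card := by simp [expSum, expChar]
      rw [this, Complex.norm_natCast]
    rw [h2] at h1
    refine h1.trans_eq (Finset.sum_congr rfl fun a ha => ?_)
    rw [zero_add, hsumP s hs a ha]
  have hfinal := hlow.trans hls
  have hA0 : (0 : ℝ) < A.card := by
    have := Finset.card_pos.2 ⟨n0, hn0⟩; positivity
  have h7 : (A.card * ∑ s ∈ 𝒮, ∏ p ∈ s, w p) * (A.card : ℝ)
      ≤ (Real.exp (4 * Real.pi) * M) * A.card := by nlinarith
  exact le_of_mul_le_mul_right h7 hA0

lemma residueCount_pos {B : Finset ℕ} (hB : B.Nonempty) (p : ℕ) : 0 < residueCount B p :=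
  Finset.card_pos.2 (hB.image _)

lemma residueCount_le {p : ℕ} (hp : 0 < p) (B : Finset ℕ) : residueCount B p ≤ p := by
  have : B.image (· % p) ⊆ Finset.range p := by
    intro h hh
    obtain ⟨n, _, rfl⟩ := Finset.mem_image.1 hh
    exact Finset.mem_range.2 (Nat.mod_lt _ hp)
  simpa [residueCount] using Finset.card_le_card this

lemma residueCount_eq_card {B : Finset ℕ} {p : ℕ} (h : ∀ b ∈ B, b < p) :
    residueCount B p = B.card := by
  apply Finset.card_image_of_injOn
  intro a ha b hb hab
  simpa [Nat.mod_eq_of_lt (h a ha), Nat.mod_eq_of_lt (h b hb)] using hab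

/-- The classes of `A` are disjoint from the negatives of the classes of `B`. -/
lemma residueCount_add_le {A B : Finset ℕ} {p : ℕ} (hp : 0 < p)
    (h : ∀ a ∈ A, ∀ b ∈ B, ¬ p ∣ a + b) : residueCount A p + residueCount B p ≤ p := by
  classical
  set f : ℕ → ℕ := fun h => (p - h) % p with hf
  have hinj : Set.InjOn f (B.image (· % p)) := by
    intro u hu v hv huv
    obtain ⟨b, _, rfl⟩ := Finset.mem_image.1 (Finset.mem_coe.1 hu)
    obtain ⟨c, _, rfl⟩ := Finset.mem_image.1 (Finset.mem_coe.1 hv)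
    have h1 := Nat.mod_lt b hp
    have h2 := Nat.mod_lt c hp
    have h3 : (p - b % p) ≡ (p - c % p) [MOD p] := huv
    have h4 : (p - b % p) + (b % p + c % p) ≡ (p - c % p) + (b % p + c % p) [MOD p] :=
      h3.add_right _
    have h5 : (p - b % p) + (b % p + c % p) = p + c % p := by omega
    have h6 : (p - c % p) + (b % p + c % p) = p + b % p := by omega
    rw [h5, h6, Nat.ModEq, Nat.add_mod_left, Nat.add_mod_left, Nat.mod_mod, Nat.mod_mod] at h4
    exact h4.symm
  have hdisj : Disjoint (A.image (· % p)) ((B.image (· % p)).image f) := by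
    rw [Finset.disjoint_left]
    intro u hu hv
    obtain ⟨a, ha, rfl⟩ := Finset.mem_image.1 hu
    obtain ⟨v, hv, hva⟩ := Finset.mem_image.1 hv
    obtain ⟨b, hb, rfl⟩ := Finset.mem_image.1 hv
    apply h a ha b hb
    have h1 := Nat.mod_lt b hp
    have h2 : (p - b % p) ≡ a [MOD p] := hva
    have h3 : (p - b % p) + b % p ≡ a + b [MOD p] := h2.add (Nat.mod_modEq b p)
    rw [Nat.sub_add_cancel h1.le] at h3
    exact (Nat.modEq_zero_iff_dvd.1 (h3.symm.trans (Nat.modEq_zero_iff_dvd.2 dvd_rfl)))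
  have hsub : A.image (· % p) ∪ (B.image (· % p)).image f ⊆ Finset.range p := by
    intro u hu
    rw [Finset.mem_range]
    rcases Finset.mem_union.1 hu with hu | hu
    · obtain ⟨a, _, rfl⟩ := Finset.mem_image.1 hu
      exact Nat.mod_lt _ hp
    · obtain ⟨v, _, rfl⟩ := Finset.mem_image.1 hu
      exact Nat.mod_lt _ hp
  have := Finset.card_le_card hsub
  rw [Finset.card_union_of_disjoint hdisj, Finset.card_image_of_injOn hinj,
    Finset.card_range] at this
  exact this

/-- The large sieve for a set `A` such that no element of `A + B` is divisible by a sieving prime. -/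
theorem large_sieve_sumset (A B : Finset ℕ) (M : ℕ) (hA : ∀ n ∈ A, n < M)
    (𝒮 : Finset (Finset ℕ))
    (h𝒮 : ∀ s ∈ 𝒮, ∀ p ∈ s, p.Prime ∧ ∀ a ∈ A, ∀ b ∈ B, ¬ p ∣ a + b)
    (hsize : ∀ s ∈ 𝒮, (∏ p ∈ s, p) ^ 2 ≤ M) :
    A.card * ∑ s ∈ 𝒮, ∏ p ∈ s, ((residueCount B p : ℝ) / p) ≤ Real.exp (4 * Real.pi) * M := by
  -- The weight is `ν / p` with `ν = residueCount B p`. It is admissible because `(1 + ν/p)(p - ν) =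
  -- p - ν²/p ≤ p`.
  apply arithmetic_large_sieve A M hA _ (fun p => by positivity) 𝒮 _ hsize
  intro s hs p hp
  obtain ⟨hpp, hab⟩ := h𝒮 s hs p hp
  refine ⟨hpp, ?_⟩
  have h1 := residueCount_add_le hpp.pos hab
  have h2 : (residueCount A p : ℝ) ≤ p - residueCount B p := by
    rw [le_sub_iff_add_le]; exact_mod_cast h1
  have hp0 : (0 : ℝ) < p := by exact_mod_cast hpp.pos
  calc (1 + (residueCount B p : ℝ) / p) * residueCount A p
      ≤ (1 + (residueCount B p : ℝ) / p) * (p - residueCount B p) := by gcongr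
    _ = p - (residueCount B p : ℝ) ^ 2 / p := by field_simp; ring
    _ ≤ p := by
      have : 0 ≤ (residueCount B p : ℝ) ^ 2 / p := by positivity
      linarith

/-! ### Gallagher's larger sieve -/

lemma sum_log_dvd_le (P : Finset ℕ) (hP : ∀ p ∈ P, p.Prime) {n : ℕ} (hn : 0 < n) :
    ∑ p ∈ P with p ∣ n, Real.log p ≤ Real.log n := by
  have h1 : (∏ p ∈ P with p ∣ n, p) ∣ n := by
    apply Finset.prod_primes_dvd
    · intro p hp; exact (hP p (Finset.mem_filter.1 hp).1).prime
    · intro p hp; exact (Finset.mem_filter.1 hp).2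
  have h2 : ((∏ p ∈ P with p ∣ n, p : ℕ) : ℝ) ≤ n := Nat.cast_le.2 (Nat.le_of_dvd hn h1)
  rw [Nat.cast_prod] at h2
  rw [← Real.log_prod (fun p hp => by
    have := (hP p (Finset.mem_filter.1 hp).1).pos; positivity)]
  apply Real.log_le_log
  · apply Finset.prod_pos
    intro p hp
    have := (hP p (Finset.mem_filter.1 hp).1).pos
    positivity
  · exact h2

/-- The double sum counts the pairs congruent modulo `p`, that is, the sum of the squared class
sizes; Cauchy–Schwarz over the occupied classes does the rest. -/
lemma card_sq_le_residueCount_mul (B : Finset ℕ) (p : ℕ) :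
    (B.card : ℝ) ^ 2 ≤ residueCount B p *
      ∑ b ∈ B, ∑ b' ∈ B, (if b' % p = b % p then (1 : ℝ) else 0) := by
  have h1 : (B.card : ℝ) = ∑ h ∈ B.image (· % p), ((B.filter (fun b => b % p = h)).card : ℝ) := by
    have := Finset.card_eq_sum_card_fiberwise (f := (· % p)) (s := B) (t := B.image (· % p))
      (fun n hn => Finset.mem_coe.2 (Finset.mem_image_of_mem _ hn))
    exact_mod_cast this
  have h2 : ∑ b ∈ B, ∑ b' ∈ B, (if b' % p = b % p then (1 : ℝ) else 0)
      = ∑ h ∈ B.image (· % p), ((B.filter (fun b => b % p = h)).card : ℝ) ^ 2 := by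
    rw [← Finset.sum_fiberwise_of_maps_to (t := B.image (· % p)) (g := (· % p))
      (fun n hn => Finset.mem_image_of_mem _ hn)]
    refine Finset.sum_congr rfl fun h _ => ?_
    have : ∀ b ∈ B.filter (fun b => b % p = h),
        ∑ b' ∈ B, (if b' % p = b % p then (1 : ℝ) else 0) = (B.filter (fun b => b % p = h)).card := by
      intro b hb
      rw [(Finset.mem_filter.1 hb).2, Finset.sum_boole]
    rw [Finset.sum_congr rfl this, Finset.sum_const, nsmul_eq_mul, sq]
  rw [h2]
  nth_rewrite 1 [h1]
  exact sq_sum_le_card_mul_sum_sq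

/-- Gallagher's larger sieve. -/
theorem larger_sieve (B : Finset ℕ) (hB : B.Nonempty) (x : ℝ) (hx : 1 ≤ x)
    (hBx : ∀ b ∈ B, (b : ℝ) ≤ x) (P : Finset ℕ) (hP : ∀ p ∈ P, p.Prime) :
    ∑ p ∈ P, Real.log p / residueCount B p
      ≤ Real.log x + (∑ p ∈ P, Real.log p) / B.card := by
  have hB0 : (0 : ℝ) < B.card := by have := Finset.card_pos.2 hB; positivity
  have hlog : 0 ≤ Real.log x := Real.log_nonneg hx
  have hlp : ∀ p ∈ P, 0 ≤ Real.log p := fun p hp =>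
    Real.log_nonneg (by exact_mod_cast (hP p hp).one_lt.le)
  -- Off the diagonal, the primes with `b ≡ b'` divide a nonzero difference of size at most `x`, so
  -- they contribute at most `log x`; on the diagonal every prime counts.
  have hpair : ∀ b ∈ B, ∀ b' ∈ B, ∑ p ∈ P, Real.log p * (if b' % p = b % p then (1 : ℝ) else 0)
      ≤ Real.log x + if b = b' then ∑ p ∈ P, Real.log p else 0 := by
    intro b hb b' hb'
    simp_rw [mul_ite, mul_one, mul_zero]
    split_ifs with hbb
    · subst hbb
      simp only [if_true]; linarith
    · rw [← Finset.sum_filter, add_zero]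
      wlog hlt : b < b' generalizing b b' with H
      · have := H b' hb' b hb (Ne.symm hbb) (by omega)
        simpa only [eq_comm] using this
      have h1 : (P.filter fun p => b' % p = b % p) ⊆ P.filter fun p => p ∣ b' - b := by
        intro p hp
        rw [Finset.mem_filter] at hp ⊢
        refine ⟨hp.1, (Nat.modEq_iff_dvd' hlt.le).1 hp.2.symm⟩
      calc ∑ p ∈ P with b' % p = b % p, Real.log p ≤ ∑ p ∈ P with p ∣ b' - b, Real.log p :=
            Finset.sum_le_sum_of_subset_of_nonneg h1 fun p hp _ => hlp p (Finset.mem_filter.1 hp).1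
        _ ≤ Real.log ((b' - b : ℕ) : ℝ) := sum_log_dvd_le P hP (by omega)
        _ ≤ Real.log x := by
          apply Real.log_le_log
          · exact_mod_cast (by omega : 0 < b' - b)
          · have : ((b' - b : ℕ) : ℝ) ≤ b' := by exact_mod_cast Nat.sub_le _ _
            exact this.trans (hBx b' hb')
  have hsum : ∑ p ∈ P, Real.log p * ∑ b ∈ B, ∑ b' ∈ B, (if b' % p = b % p then (1 : ℝ) else 0)
      ≤ (B.card : ℝ) ^ 2 * Real.log x + B.card * ∑ p ∈ P, Real.log p := by
    simp_rw [Finset.mul_sum]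
    rw [Finset.sum_comm]
    calc _ ≤ ∑ b ∈ B, ∑ b' ∈ B, (Real.log x + if b = b' then ∑ p ∈ P, Real.log p else 0) := by
          refine Finset.sum_le_sum fun b hb => ?_
          rw [Finset.sum_comm]
          exact Finset.sum_le_sum fun b' hb' => hpair b hb b' hb'
      _ = ∑ b ∈ B, (B.card * Real.log x + ∑ p ∈ P, Real.log p) := by
          refine Finset.sum_congr rfl fun b hb => ?_
          rw [Finset.sum_add_distrib, Finset.sum_ite_eq]
          simp [hb]
      _ = _ := by
          rw [Finset.sum_add_distrib]
          simp only [Finset.sum_const, nsmul_eq_mul]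
          rw [Finset.mul_sum]; ring
  have hlow : (B.card : ℝ) ^ 2 * ∑ p ∈ P, Real.log p / residueCount B p
      ≤ ∑ p ∈ P, Real.log p * ∑ b ∈ B, ∑ b' ∈ B, (if b' % p = b % p then (1 : ℝ) else 0) := by
    rw [Finset.mul_sum]
    refine Finset.sum_le_sum fun p hp => ?_
    have hr : (0 : ℝ) < residueCount B p := by exact_mod_cast residueCount_pos hB p
    rw [mul_div_left_comm]
    apply mul_le_mul_of_nonneg_left _ (hlp p hp)
    rw [div_le_iff₀' hr]
    exact card_sq_le_residueCount_mul B p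
  have h := hlow.trans hsum
  have h2 : (B.card : ℝ) ^ 2 * (Real.log x + (∑ p ∈ P, Real.log p) / B.card)
      = (B.card : ℝ) ^ 2 * Real.log x + B.card * ∑ p ∈ P, Real.log p := by
    field_simp
  rw [← h2] at h
  exact le_of_mul_le_mul_left h (by positivity)

/-! ### Sieving by products of a fixed number of primes -/

/-- Each `(m + 1)`-subset arises from an `m`-subset and one new element in `m + 1` ways. -/
lemma succ_mul_sum_powersetCard_succ (P : Finset ℕ) (w : ℕ → ℝ) (m : ℕ) :
    (m + 1 : ℝ) * ∑ s ∈ P.powersetCard (m + 1), ∏ p ∈ s, w p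
      = ∑ s ∈ P.powersetCard m, (∏ p ∈ s, w p) * ∑ p ∈ P \ s, w p := by
  classical
  have h1 : (m + 1 : ℝ) * ∑ s ∈ P.powersetCard (m + 1), ∏ p ∈ s, w p
      = ∑ s ∈ P.powersetCard (m + 1), ∑ p ∈ s, ∏ p ∈ s, w p := by
    rw [Finset.mul_sum]
    refine Finset.sum_congr rfl fun s hs => ?_
    rw [Finset.sum_const, (Finset.mem_powersetCard.1 hs).2]
    simp
  rw [h1]
  simp_rw [Finset.mul_sum]
  rw [Finset.sum_sigma', Finset.sum_sigma']
  refine Finset.sum_bij' (fun x _ => ⟨x.1.erase x.2, x.2⟩) (fun x _ => ⟨insert x.2 x.1, x.2⟩)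
    ?_ ?_ ?_ ?_ ?_
  · rintro ⟨s, p⟩ h
    simp only [Finset.mem_sigma, Finset.mem_powersetCard, Finset.mem_sdiff] at h ⊢
    refine ⟨⟨(Finset.erase_subset _ _).trans h.1.1, ?_⟩, h.1.1 h.2, by simp⟩
    rw [Finset.card_erase_of_mem h.2, h.1.2]; simp
  · rintro ⟨s, p⟩ h
    simp only [Finset.mem_sigma, Finset.mem_powersetCard, Finset.mem_sdiff] at h ⊢
    refine ⟨⟨Finset.insert_subset h.2.1 h.1.1, ?_⟩, by simp⟩
    rw [Finset.card_insert_of_notMem h.2.2, h.1.2]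
  · rintro ⟨s, p⟩ h
    simp only [Finset.mem_sigma] at h
    simp [Finset.insert_erase h.2]
  · rintro ⟨s, p⟩ h
    simp only [Finset.mem_sigma, Finset.mem_sdiff] at h
    simp [Finset.erase_insert h.2.2]
  · rintro ⟨s, p⟩ h
    simp only [Finset.mem_sigma] at h
    rw [mul_comm, Finset.mul_prod_erase _ _ h.2]

/-- A lower bound for elementary symmetric polynomials at points of `[0, 1]^P`. -/
lemma pow_le_sum_powersetCard (P : Finset ℕ) (w : ℕ → ℝ) (hw0 : ∀ p ∈ P, 0 ≤ w p)
    (hw1 : ∀ p ∈ P, w p ≤ 1) (W : ℝ) (hW : W ≤ ∑ p ∈ P, w p) (m : ℕ) (hm : (m : ℝ) ≤ W) :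
    ((W - m) / m) ^ m ≤ ∑ s ∈ P.powersetCard m, ∏ p ∈ s, w p := by
  classical
  have key : ∀ k ≤ m, ((W - m) / m) ^ k ≤ ∑ s ∈ P.powersetCard k, ∏ p ∈ s, w p := by
    intro k
    induction k with
    | zero => intro _; simp
    | succ k ih =>
      intro hk
      have hm0 : (0 : ℝ) < m := by
        have : 0 < m := by omega
        positivity
      have h1 := ih (by omega)
      have h2 := succ_mul_sum_powersetCard_succ P w k
      -- A `k`-subset uses up weight at most `k`, so at least `W - k` remains for its extensions.
      -- Each step thus gains a factor `(W - k) / (k + 1) ≥ (W - m) / m`.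
      have h3 : (W - k) * ∑ s ∈ P.powersetCard k, ∏ p ∈ s, w p
          ≤ ∑ s ∈ P.powersetCard k, (∏ p ∈ s, w p) * ∑ p ∈ P \ s, w p := by
        rw [Finset.mul_sum]
        refine Finset.sum_le_sum fun s hs => ?_
        obtain ⟨hsP, hsc⟩ := Finset.mem_powersetCard.1 hs
        rw [mul_comm]
        apply mul_le_mul_of_nonneg_left _ (Finset.prod_nonneg fun p hp => hw0 p (hsP hp))
        have h4 := Finset.sum_sdiff hsP (f := w)
        have h5 : ∑ p ∈ s, w p ≤ k := by
          calc ∑ p ∈ s, w p ≤ ∑ p ∈ s, 1 := Finset.sum_le_sum fun p hp => hw1 p (hsP hp)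
            _ = k := by simp [hsc]
        linarith
      rw [← h2] at h3
      have hkm : (k : ℝ) + 1 ≤ m := by exact_mod_cast hk
      have he0 : 0 ≤ ((W - m) / m) ^ k := pow_nonneg (div_nonneg (by linarith) hm0.le) _
      have hk1 : (0 : ℝ) < k + 1 := by positivity
      have h6 : (W - k) / (k + 1) * ∑ s ∈ P.powersetCard k, ∏ p ∈ s, w p
          ≤ ∑ s ∈ P.powersetCard (k + 1), ∏ p ∈ s, w p := by
        rw [div_mul_eq_mul_div, div_le_iff₀ hk1]; linarith
      refine le_trans ?_ h6
      rw [pow_succ, mul_comm]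
      apply mul_le_mul _ h1 he0
      · apply div_nonneg _ hk1.le; linarith
      · rw [div_le_div_iff₀ hm0 hk1]
        nlinarith
  exact key m le_rfl

/-- The moduli are the products of `m` distinct primes of `P`, all at most `y ^ m ≤ √M`. -/
theorem card_mul_pow_le (A B : Finset ℕ) (M : ℕ) (hA : ∀ n ∈ A, n < M) (P : Finset ℕ)
    (hP : ∀ p ∈ P, p.Prime ∧ ∀ a ∈ A, ∀ b ∈ B, ¬ p ∣ a + b) (y : ℝ)
    (hy : ∀ p ∈ P, (p : ℝ) ≤ y) (m : ℕ) (hym : (y ^ m) ^ 2 ≤ M)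
    (W : ℝ) (hW : W ≤ ∑ p ∈ P, (residueCount B p : ℝ) / p) (hmW : (m : ℝ) ≤ W) :
    A.card * ((W - m) / m) ^ m ≤ Real.exp (4 * Real.pi) * M := by
  have h1 := large_sieve_sumset A B M hA (P.powersetCard m)
    (fun s hs p hp => hP p ((Finset.mem_powersetCard.1 hs).1 hp)) (by
      intro s hs
      obtain ⟨hsP, hsc⟩ := Finset.mem_powersetCard.1 hs
      have h2 : ((∏ p ∈ s, p : ℕ) : ℝ) ≤ y ^ m := by
        push_cast
        rw [← hsc, ← Finset.prod_const]
        exact Finset.prod_le_prod (fun p _ => Nat.cast_nonneg p) fun p hp => hy p (hsP hp)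
      have h3 : (((∏ p ∈ s, p : ℕ) : ℝ)) ^ 2 ≤ M := le_trans (by gcongr) hym
      exact_mod_cast h3)
  refine le_trans ?_ h1
  gcongr
  refine pow_le_sum_powersetCard P _ (fun p _ => by positivity) (fun p hp => ?_) W hW m hmW
  have hp0 : (0 : ℝ) < p := by exact_mod_cast (hP p hp).1.pos
  rw [div_le_one hp0]
  exact_mod_cast residueCount_le (hP p hp).1.pos B

/-- A lower bound for the number of residue classes met by a large set, on average over the
primes of a short range. -/
theorem le_sum_residueCount_div (B : Finset ℕ) (x y H c : ℝ) (hx : 2 ≤ Real.log x)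
    (hBx : ∀ b ∈ B, (b : ℝ) ≤ x) (hy : 1 < y) (hBy : y ≤ B.card) (hH : 0 < H) (hc : 0 ≤ c)
    (P : Finset ℕ) (hP : ∀ p ∈ P, p.Prime ∧ y / H ≤ p ∧ (p : ℝ) ≤ y)
    (hcP : c ≤ ∑ p ∈ P, Real.log p / p) :
    c ^ 2 * y / (2 * H * Real.log x * Real.log y) ≤ ∑ p ∈ P, (residueCount B p : ℝ) / p := by
  have hB : B.Nonempty := by
    rw [← Finset.card_pos]
    have : (0 : ℝ) < B.card := by linarith
    exact_mod_cast this
  have hx1 : 1 ≤ x := by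
    by_contra h
    push Not at h
    have hb := hBx _ hB.choose_spec
    have : Real.log x ≤ 0 := Real.log_nonpos ((Nat.cast_nonneg _).trans hb) h.le
    linarith
  have hlogy : 0 < Real.log y := Real.log_pos hy
  have hB0 : (0 : ℝ) < B.card := by linarith
  have h1 := larger_sieve B hB x hx1 hBx P fun p hp => (hP p hp).1
  have h2 : ∑ p ∈ P, Real.log p ≤ 2 * y := by
    calc ∑ p ∈ P, Real.log p ≤ Chebyshev.theta y := by
          rw [Chebyshev.theta_eq_sum_Icc]
          apply Finset.sum_le_sum_of_subset_of_nonneg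
          · intro p hp
            obtain ⟨h1, _, h3⟩ := hP p hp
            simp only [Finset.mem_filter, Finset.mem_Icc]
            exact ⟨⟨Nat.zero_le _, Nat.le_floor h3⟩, h1⟩
          · intro p hp _
            exact Real.log_nonneg (by exact_mod_cast (Finset.mem_filter.1 hp).2.one_lt.le)
      _ ≤ Real.log 4 * y := Chebyshev.theta_le_log4_mul_x (by linarith)
      _ ≤ 2 * y := by
        have : Real.log 4 ≤ 2 := by
          have : (4 : ℝ) = 2 ^ 2 := by norm_num
          rw [this, Real.log_pow]
          have := Real.log_two_lt_d9
          push_cast; linarith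
        gcongr
  -- Since `y ≤ B.card`, the second term of the larger sieve is at most `2 ≤ log x`.
  have h3 : ∑ p ∈ P, Real.log p / residueCount B p ≤ 2 * Real.log x := by
    have : (∑ p ∈ P, Real.log p) / B.card ≤ 2 := by
      rw [div_le_iff₀ hB0]; linarith
    linarith
  -- Cauchy–Schwarz with `(log p / p)² = (ν/p · log p / p) · (log p / ν)`: the larger sieve bounds
  -- the second sum, and `log p / p ≤ H log y / y` on the window turns the first into the sum
  -- sought.
  have hcs := Finset.sum_sq_le_sum_mul_sum_of_sq_le_mul P
    (r := fun p : ℕ => Real.log p / p) (f := fun p : ℕ => (residueCount B p : ℝ) / p * (Real.log p / p))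
    (g := fun p : ℕ => Real.log p / residueCount B p)
    (fun p hp => mul_nonneg (by positivity) (div_nonneg (Real.log_natCast_nonneg _) (by positivity)))
    (fun p hp => div_nonneg (Real.log_natCast_nonneg _) (by positivity))
    (fun p hp => by
      have hp0 : (0 : ℝ) < p := by exact_mod_cast (hP p hp).1.pos
      have hr : (0 : ℝ) < residueCount B p := by exact_mod_cast residueCount_pos hB p
      apply le_of_eq
      field_simp)
  have h4 : ∑ p ∈ P, (residueCount B p : ℝ) / p * (Real.log p / p)
      ≤ (∑ p ∈ P, (residueCount B p : ℝ) / p) * (Real.log y * H / y) := by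
    rw [Finset.sum_mul]
    refine Finset.sum_le_sum fun p hp => ?_
    obtain ⟨hpp, hpl, hpu⟩ := hP p hp
    have hp0 : (0 : ℝ) < p := by exact_mod_cast hpp.pos
    apply mul_le_mul_of_nonneg_left _ (by positivity)
    rw [div_le_div_iff₀ hp0 (by linarith)]
    have h5 : Real.log p ≤ Real.log y := Real.log_le_log hp0 hpu
    have h6 : y ≤ p * H := by rwa [div_le_iff₀ hH] at hpl
    calc Real.log p * y ≤ Real.log y * (p * H) := by gcongr
      _ = _ := by ring
  set R := ∑ p ∈ P, (residueCount B p : ℝ) / p with hR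
  have hR0 : 0 ≤ R := Finset.sum_nonneg fun p _ => by positivity
  have h5 : c ^ 2 ≤ R * (Real.log y * H / y) * (2 * Real.log x) := by
    calc c ^ 2 ≤ (∑ p ∈ P, Real.log p / p) ^ 2 := by gcongr
      _ ≤ _ := hcs
      _ ≤ _ := by
        apply mul_le_mul h4 h3
        · exact Finset.sum_nonneg fun p _ => div_nonneg (Real.log_natCast_nonneg _) (by positivity)
        · have : 0 < y := by linarith
          positivity
  rw [div_le_iff₀ (by positivity)]
  have hy0 : 0 < y := by linarith
  have h7 := mul_le_mul_of_nonneg_right h5 hy0.le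
  calc c ^ 2 * y ≤ _ := h7
    _ = _ := by field_simp

/-! ### Mertens' first theorem -/

open scoped Classical in
/-- The elements of `U` in `[1, x]`. -/
noncomputable def upTo (U : Set ℕ) (x : ℝ) : Finset ℕ :=
  (Finset.Icc 1 ⌊x⌋₊).filter (fun p => p ∈ U)

lemma mem_upTo {U : Set ℕ} {x : ℝ} {n : ℕ} : n ∈ upTo U x ↔ 0 < n ∧ (n : ℝ) ≤ x ∧ n ∈ U := by
  classical
  rw [upTo, Finset.mem_filter, Finset.mem_Icc]
  constructor
  · rintro ⟨⟨h1, h2⟩, h3⟩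
    exact ⟨h1, (Nat.le_floor_iff' (by omega)).1 h2, h3⟩
  · rintro ⟨h1, h2, h3⟩
    exact ⟨⟨h1, (Nat.le_floor_iff' (by omega)).2 h2⟩, h3⟩

lemma upTo_mono (U : Set ℕ) {x y : ℝ} (h : x ≤ y) : upTo U x ⊆ upTo U y := by
  intro n hn
  rw [mem_upTo] at hn ⊢
  exact ⟨hn.1, hn.2.1.trans h, hn.2.2⟩

lemma logPrimeSum_eq (U : Set ℕ) (x : ℝ) :
    logPrimeSum U x = ∑ p ∈ upTo U x, Real.log p / p := rfl

lemma log_natCast_div_nonneg (p : ℕ) : 0 ≤ Real.log p / p :=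
  div_nonneg (Real.log_natCast_nonneg _) (Nat.cast_nonneg _)

lemma logPrimeSum_mono (U : Set ℕ) : Monotone (logPrimeSum U) := fun x y h => by
  rw [logPrimeSum_eq, logPrimeSum_eq]
  exact Finset.sum_le_sum_of_subset_of_nonneg (upTo_mono U h) fun p _ _ => log_natCast_div_nonneg p

lemma logPrimeSum_floor (U : Set ℕ) (x : ℝ) : logPrimeSum U x = logPrimeSum U ⌊x⌋₊ := by
  rw [logPrimeSum, logPrimeSum, Nat.floor_natCast]

lemma log_factorial_eq (N : ℕ) :
    Real.log (N.factorial : ℝ) =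
      ∑ p ∈ upTo {p | p.Prime} N, (padicValNat p N.factorial : ℝ) * Real.log p := by
  have h1 : (N.factorial).primeFactors ⊆ upTo {p | p.Prime} N := by
    intro p hp
    have hpp := Nat.prime_of_mem_primeFactors hp
    rw [mem_upTo]
    refine ⟨hpp.pos, ?_, hpp⟩
    exact_mod_cast (hpp.dvd_factorial).1 (Nat.dvd_of_mem_primeFactors hp)
  have h2 : ((N.factorial : ℕ) : ℝ) = ∏ p ∈ upTo {p | p.Prime} N, (p : ℝ) ^ padicValNat p N.factorial := by
    rw [← Finset.prod_subset h1]
    · have h3 := Nat.prod_factorization_pow_eq_self (Nat.factorial_ne_zero N)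
      conv_lhs => rw [← h3]
      rw [Finsupp.prod, Nat.support_factorization]
      push_cast
      refine Finset.prod_congr rfl fun p hp => ?_
      rw [Nat.factorization_def _ (Nat.prime_of_mem_primeFactors hp)]
    · intro p hp hp2
      have hpp : p.Prime := (mem_upTo.1 hp).2.2
      rw [← Nat.factorization_def _ hpp, Finsupp.notMem_support_iff.1 (by
        rwa [Nat.support_factorization]), pow_zero]
  rw [h2, Real.log_prod]
  · refine Finset.sum_congr rfl fun p _ => ?_
    rw [Real.log_pow]
  · intro p hp
    have := (mem_upTo.1 hp).1
    positivity

lemma sum_upTo_log_le (U : Set ℕ) (hU : ∀ p ∈ U, p.Prime) {x : ℝ} (hx : 0 ≤ x) :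
    ∑ p ∈ upTo U x, Real.log p ≤ 2 * x := by
  calc ∑ p ∈ upTo U x, Real.log p ≤ Chebyshev.theta x := by
        rw [Chebyshev.theta_eq_sum_Icc]
        apply Finset.sum_le_sum_of_subset_of_nonneg
        · intro p hp
          rw [mem_upTo] at hp
          simp only [Finset.mem_filter, Finset.mem_Icc]
          exact ⟨⟨Nat.zero_le _, Nat.le_floor hp.2.1⟩, hU p hp.2.2⟩
        · intro p hp _
          exact Real.log_natCast_nonneg _
    _ ≤ Real.log 4 * x := Chebyshev.theta_le_log4_mul_x hx
    _ ≤ 2 * x := by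
      have : Real.log 4 ≤ 2 := by
        have : (4 : ℝ) = 2 ^ 2 := by norm_num
        rw [this, Real.log_pow]
        have := Real.log_two_lt_d9
        push_cast; linarith
      gcongr

/-- The exponent of `p` in `N!` is at least `⌊N/p⌋ ≥ N/p - 1`, and `N! ≤ N^N`; Chebyshev's bound
controls the terms `-1`. -/
lemma logPrimeSum_prime_le (N : ℕ) (hN : 0 < N) :
    logPrimeSum {p | p.Prime} N ≤ Real.log N + 2 := by
  have hN0 : (0 : ℝ) < N := by positivity
  have h1 : ∑ p ∈ upTo {p | p.Prime} N, ((N : ℝ) / p - 1) * Real.log p ≤ Real.log (N.factorial : ℝ) := by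
    rw [log_factorial_eq]
    refine Finset.sum_le_sum fun p hp => ?_
    have hpp : p.Prime := (mem_upTo.1 hp).2.2
    have := Fact.mk hpp
    apply mul_le_mul_of_nonneg_right _ (Real.log_natCast_nonneg _)
    have h2 : N / p ≤ padicValNat p N.factorial := by
      rw [padicValNat_factorial (b := Nat.log p N + 2) (by omega)]
      have := Finset.single_le_sum (f := fun i => N / p ^ i) (s := Finset.Ico 1 (Nat.log p N + 2))
        (fun i _ => Nat.zero_le _) (a := 1) (by simp)
      simpa using this
    have h3 : (N : ℝ) / p - 1 ≤ ((N / p : ℕ) : ℝ) := by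
      have hp0 : (0 : ℝ) < p := by exact_mod_cast hpp.pos
      have h4 : N < (N / p + 1) * p := by
        have := Nat.lt_mul_div_succ N hpp.pos
        linarith
      have h5 : (N : ℝ) < ((N / p : ℕ) + 1) * p := by exact_mod_cast h4
      have := (div_lt_iff₀ hp0).2 h5
      linarith
    exact h3.trans (by exact_mod_cast h2)
  have h2 : Real.log (N.factorial : ℝ) ≤ N * Real.log N := by
    rw [← Real.log_pow]
    apply Real.log_le_log (by exact_mod_cast Nat.factorial_pos N)
    exact_mod_cast Nat.factorial_le_pow N
  have h3 := sum_upTo_log_le {p | p.Prime} (fun p hp => hp) hN0.le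
  have h4 : ∑ p ∈ upTo {p | p.Prime} N, ((N : ℝ) / p - 1) * Real.log p
      = N * logPrimeSum {p | p.Prime} N - ∑ p ∈ upTo {p | p.Prime} N, Real.log p := by
    rw [logPrimeSum_eq, Finset.mul_sum, ← Finset.sum_sub_distrib]
    refine Finset.sum_congr rfl fun p _ => ?_
    ring
  have h5 : N * logPrimeSum {p | p.Prime} N ≤ N * (Real.log N + 2) := by linarith
  exact le_of_mul_le_mul_left h5 hN0

/-- A telescoping bound for `∑ 1 / (n (n - 1))`. -/
lemma sum_one_div_mul_sub_one_le (P : Finset ℕ) (hP : ∀ p ∈ P, 2 ≤ p) :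
    ∑ p ∈ P, 1 / ((p : ℝ) * (p - 1)) ≤ 1 := by
  have h1 : ∀ N : ℕ, ∑ n ∈ Finset.Ico 2 (N + 2), 1 / ((n : ℝ) * (n - 1)) = 1 - 1 / (N + 1) := by
    intro N
    induction N with
    | zero => simp
    | succ N ih =>
      rw [Finset.sum_Ico_succ_top (by omega), ih]
      push_cast
      have : (N : ℝ) + 2 - 1 = N + 1 := by ring
      rw [this]
      field_simp
      ring
  have h2 : P ⊆ Finset.Ico 2 (P.sup id + 2) := by
    intro p hp
    rw [Finset.mem_Ico]
    have := Finset.le_sup (f := id) hp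
    simp only [id] at this
    exact ⟨hP p hp, by omega⟩
  calc ∑ p ∈ P, 1 / ((p : ℝ) * (p - 1)) ≤ ∑ n ∈ Finset.Ico 2 (P.sup id + 2), 1 / ((n : ℝ) * (n - 1)) := by
        apply Finset.sum_le_sum_of_subset_of_nonneg h2
        intro n hn _
        have : (2 : ℝ) ≤ n := by exact_mod_cast (Finset.mem_Ico.1 hn).1
        have : (0 : ℝ) ≤ n - 1 := by linarith
        positivity
    _ ≤ 1 := by
      rw [h1]
      have : (0 : ℝ) ≤ 1 / (((P.sup id : ℕ) : ℝ) + 1) := by positivity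
      linarith

/-- The bound `log n ≤ 2√n` compares the terms with a telescoping series in `1/√n`. Any absolute
constant would do. -/
lemma sum_log_div_mul_sub_one_le (P : Finset ℕ) (hP : ∀ p ∈ P, 2 ≤ p) :
    ∑ p ∈ P, Real.log p / ((p : ℝ) * (p - 1)) ≤ 12 := by
  have hterm : ∀ n : ℕ, 2 ≤ n →
      Real.log n / ((n : ℝ) * (n - 1)) ≤ 8 * (1 / Real.sqrt ((n : ℝ) - 1) - 1 / Real.sqrt n) := by
    intro n hn
    have hn2 : (2 : ℝ) ≤ n := by exact_mod_cast hn
    set a := Real.sqrt ((n : ℝ) - 1) with ha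
    set b := Real.sqrt (n : ℝ) with hb
    have ha0 : 0 < a := Real.sqrt_pos.2 (by linarith)
    have hb0 : 0 < b := Real.sqrt_pos.2 (by linarith)
    have ha2 : a ^ 2 = n - 1 := Real.sq_sqrt (by linarith)
    have hb2 : b ^ 2 = n := Real.sq_sqrt (by linarith)
    have hab : a ≤ b := Real.sqrt_le_sqrt (by linarith)
    have hlog : Real.log n ≤ 2 * b := by
      rw [← hb2, Real.log_pow]
      have := Real.log_le_sub_one_of_pos hb0
      push_cast; linarith
    have hdiff : 1 / a - 1 / b = 1 / (a * b * (a + b)) := by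
      have : (b - a) * (b + a) = 1 := by nlinarith
      field_simp
      nlinarith
    have hba : b ^ 2 ≤ 2 * a ^ 2 := by nlinarith
    rw [hdiff, ← ha2, ← hb2]
    rw [hb2]
    rw [mul_one_div, div_le_div_iff₀ (by nlinarith [mul_pos ha0 ha0]) (by positivity)]
    have h1 : a * b * (a + b) ≤ 2 * (a * b * b) := by
      nlinarith [mul_pos ha0 hb0]
    calc Real.log n * (a * b * (a + b)) ≤ (2 * b) * (2 * (a * b * b)) := by gcongr
      _ ≤ 8 * (b ^ 2 * a ^ 2) := by
        have hba' : b ≤ 2 * a := by nlinarith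
        have h3 : a * b ^ 2 * b ≤ a * b ^ 2 * (2 * a) := by gcongr
        nlinarith
      _ = 8 * (n * a ^ 2) := by rw [hb2]
  have h1 : ∀ N : ℕ, ∑ n ∈ Finset.Ico 2 (N + 2), (1 / Real.sqrt ((n : ℝ) - 1) - 1 / Real.sqrt n)
      = 1 - 1 / Real.sqrt (N + 1) := by
    intro N
    induction N with
    | zero => simp
    | succ N ih =>
      rw [Finset.sum_Ico_succ_top (by omega), ih]
      push_cast
      have : (N : ℝ) + 2 - 1 = N + 1 := by ring
      rw [this]
      have : (N : ℝ) + 1 + 1 = N + 2 := by ring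
      rw [this]; ring
  have h2 : P ⊆ Finset.Ico 2 (P.sup id + 2) := by
    intro p hp
    rw [Finset.mem_Ico]
    have := Finset.le_sup (f := id) hp
    simp only [id] at this
    exact ⟨hP p hp, by omega⟩
  calc ∑ p ∈ P, Real.log p / ((p : ℝ) * (p - 1))
      ≤ ∑ n ∈ Finset.Ico 2 (P.sup id + 2), Real.log n / ((n : ℝ) * (n - 1)) := by
        apply Finset.sum_le_sum_of_subset_of_nonneg h2
        intro n hn _
        have : (2 : ℝ) ≤ n := by exact_mod_cast (Finset.mem_Ico.1 hn).1
        have : (0 : ℝ) ≤ n - 1 := by linarith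
        exact div_nonneg (Real.log_natCast_nonneg _) (by positivity)
    _ ≤ ∑ n ∈ Finset.Ico 2 (P.sup id + 2), 8 * (1 / Real.sqrt ((n : ℝ) - 1) - 1 / Real.sqrt n) :=
        Finset.sum_le_sum fun n hn => hterm n (Finset.mem_Ico.1 hn).1
    _ ≤ 12 := by
      rw [← Finset.mul_sum, h1]
      have : (0 : ℝ) ≤ 1 / Real.sqrt (((P.sup id : ℕ) : ℝ) + 1) := by positivity
      linarith

/-- By Legendre the exponent of `p` in `N!` is at most `N/(p-1) = N/p + N/(p(p-1))`, and `log N! ≥ N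
log N - N`; hence `13 = 12 + 1`. -/
lemma le_logPrimeSum_prime (N : ℕ) (hN : 0 < N) :
    Real.log N - 13 ≤ logPrimeSum {p | p.Prime} N := by
  have hN0 : (0 : ℝ) < N := by positivity
  have h1 : Real.log (N.factorial : ℝ) ≤
      ∑ p ∈ upTo {p | p.Prime} N, N * (Real.log p / p + Real.log p / ((p : ℝ) * (p - 1))) := by
    rw [log_factorial_eq]
    refine Finset.sum_le_sum fun p hp => ?_
    have hpp : p.Prime := (mem_upTo.1 hp).2.2
    have := Fact.mk hpp
    have hp2 : (2 : ℝ) ≤ p := by exact_mod_cast hpp.two_le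
    have hp1 : (0 : ℝ) < p - 1 := by linarith
    have h2 : (padicValNat p N.factorial : ℝ) ≤ N / (p - 1) := by
      rw [le_div_iff₀' hp1]
      have h3 := sub_one_mul_padicValNat_factorial (p := p) N
      have h4 : (p - 1) * padicValNat p N.factorial ≤ N := by rw [h3]; exact Nat.sub_le _ _
      have h5 : ((p - 1 : ℕ) : ℝ) * padicValNat p N.factorial ≤ N := by exact_mod_cast h4
      rwa [Nat.cast_sub hpp.one_lt.le, Nat.cast_one] at h5
    calc (padicValNat p N.factorial : ℝ) * Real.log p ≤ N / (p - 1) * Real.log p :=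
          mul_le_mul_of_nonneg_right h2 (Real.log_natCast_nonneg _)
      _ = _ := by field_simp; ring
  rw [← Finset.mul_sum, Finset.sum_add_distrib, ← logPrimeSum_eq] at h1
  have h2 := sum_log_div_mul_sub_one_le (upTo {p | p.Prime} N) fun p hp =>
    ((mem_upTo.1 hp).2.2 : p.Prime).two_le
  have h3 : N * Real.log N - N ≤ Real.log (N.factorial : ℝ) := by
    have h4 := Real.pow_div_factorial_le_exp (N : ℝ) hN0.le N
    have h5 := Real.log_le_log (by positivity) h4
    rw [Real.log_exp, Real.log_div (by positivity) (by positivity), Real.log_pow] at h5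
    linarith
  have h4 : N * (Real.log N - 13) ≤ N * logPrimeSum {p | p.Prime} N := by
    have h5 := mul_le_mul_of_nonneg_left h2 hN0.le
    linarith
  exact le_of_mul_le_mul_left h4 hN0

/-- Mertens' first theorem. -/
theorem abs_logPrimeSum_prime_sub_log_le {x : ℝ} (hx : 1 ≤ x) :
    |logPrimeSum {p | p.Prime} x - Real.log x| ≤ 14 := by
  have hN : 0 < ⌊x⌋₊ := Nat.floor_pos.2 hx
  have hN1 : (1 : ℝ) ≤ ⌊x⌋₊ := by exact_mod_cast hN
  rw [logPrimeSum_floor]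
  have h1 := logPrimeSum_prime_le _ hN
  have h2 := le_logPrimeSum_prime _ hN
  have h3 : Real.log ⌊x⌋₊ ≤ Real.log x :=
    Real.log_le_log (by positivity) (Nat.floor_le (by linarith))
  have h4 : Real.log x ≤ Real.log ⌊x⌋₊ + 1 := by
    have h5 : x ≤ 2 * ⌊x⌋₊ := by have := Nat.lt_floor_add_one x; linarith
    have h6 := Real.log_le_log (by linarith) h5
    rw [Real.log_mul (by norm_num) (by positivity)] at h6
    have := Real.log_two_lt_d9
    linarith
  rw [abs_le]; constructor <;> linarith

/-! ### Sets of primes with a logarithmic density -/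

/-- `U` is a set of primes with `∑_{p ≤ x, p ∈ U} log p / p = σ log x + O(1)`, the implied constant
being `C`. -/
structure HasLogDensity (U : Set ℕ) (σ C : ℝ) : Prop where
  prime : ∀ p ∈ U, p.Prime
  abs_sub_le : ∀ x : ℝ, 1 ≤ x → |logPrimeSum U x - σ * Real.log x| ≤ C

/-- The sum of the reciprocals of the elements of `U` up to `x`. -/
noncomputable def recipSum (U : Set ℕ) (x : ℝ) : ℝ := ∑ p ∈ upTo U x, 1 / (p : ℝ)

/-- Past some `Y` the error is at most `1 + |C|`; below `Y` both terms are bounded by their values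
at `Y`. -/
lemma hasLogDensity_of_isLittleO {T : Set ℕ} (hT : ∀ p ∈ T, p.Prime) {τ C : ℝ} (hτ : 0 ≤ τ)
    (hsum : (fun x : ℝ => logPrimeSum T x - (τ * Real.log x + C))
      =o[atTop] (fun _ : ℝ => (1 : ℝ))) : ∃ C', HasLogDensity T τ C' := by
  have h1 := hsum.bound one_pos
  obtain ⟨X, hX⟩ := eventually_atTop.1 h1
  set Y := max X 1 with hY
  have hY1 : 1 ≤ Y := le_max_right _ _
  have hY0 := hX Y (le_max_left _ _)
  have hlY : 0 ≤ Real.log Y := Real.log_nonneg hY1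
  refine ⟨1 + |C| + logPrimeSum T Y + τ * Real.log Y, hT, fun x hx => ?_⟩
  have hTY : 0 ≤ logPrimeSum T Y := Finset.sum_nonneg fun p _ => log_natCast_div_nonneg p
  have hx0 : 0 ≤ logPrimeSum T x := Finset.sum_nonneg fun p _ => log_natCast_div_nonneg p
  have hlx : 0 ≤ Real.log x := Real.log_nonneg hx
  rcases le_total x Y with h | h
  · have h2 := logPrimeSum_mono T h
    have h3 : τ * Real.log x ≤ τ * Real.log Y := by
      gcongr
    have h4 : 0 ≤ τ * Real.log x := by positivity
    have h5 := abs_nonneg C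
    rw [abs_le]; constructor <;> linarith
  · have h2 := hX x ((le_max_left _ _).trans h)
    simp only [Real.norm_eq_abs, norm_one, mul_one] at h2
    have h3 : logPrimeSum T x - τ * Real.log x = (logPrimeSum T x - (τ * Real.log x + C)) + C := by
      ring
    have h4 : 0 ≤ τ * Real.log Y := by positivity
    calc _ ≤ |logPrimeSum T x - (τ * Real.log x + C)| + |C| := by rw [h3]; exact abs_add_le _ _
      _ ≤ _ := by linarith

/-- The primes outside a set of primes of logarithmic density `τ` have density `1 - τ`. -/
lemma HasLogDensity.compl {T : Set ℕ} {τ C : ℝ} (h : HasLogDensity T τ C) :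
    HasLogDensity {p | p.Prime ∧ p ∉ T} (1 - τ) (C + 14) := by
  classical
  refine ⟨fun p hp => hp.1, fun x hx => ?_⟩
  have h1 := h.abs_sub_le x hx
  have h2 := abs_logPrimeSum_prime_sub_log_le hx
  have h3 : logPrimeSum {p | p.Prime} x = logPrimeSum T x + logPrimeSum {p | p.Prime ∧ p ∉ T} x := by
    rw [logPrimeSum_eq, logPrimeSum_eq, logPrimeSum_eq, ← Finset.sum_union]
    · refine Finset.sum_congr ?_ fun _ _ => rfl
      ext p
      simp only [Finset.mem_union, mem_upTo, Set.mem_ofPred_eq]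
      have := h.prime p
      tauto
    · rw [Finset.disjoint_left]
      intro p hp hp'
      exact (mem_upTo.1 hp').2.2.2 (mem_upTo.1 hp).2.2
  rw [abs_le] at *
  constructor <;> nlinarith

namespace HasLogDensity

variable {U : Set ℕ} {σ C : ℝ}

lemma nonneg (h : HasLogDensity U σ C) : 0 ≤ C := (abs_nonneg _).trans (h.abs_sub_le 1 le_rfl)

lemma sum_sdiff_ge (h : HasLogDensity U σ C) {z x : ℝ} (hz : 1 ≤ z) (hzx : z ≤ x) :
    σ * (Real.log x - Real.log z) - 2 * C ≤ ∑ p ∈ upTo U x \ upTo U z, Real.log p / p := by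
  classical
  have h1 := h.abs_sub_le x (hz.trans hzx)
  have h2 := h.abs_sub_le z hz
  have h3 := Finset.sum_sdiff (upTo_mono U hzx) (f := fun p : ℕ => Real.log p / p)
  rw [← logPrimeSum_eq, ← logPrimeSum_eq] at h3
  rw [abs_le] at h1 h2
  linarith

lemma sum_sdiff_le (h : HasLogDensity U σ C) {z x : ℝ} (hz : 1 ≤ z) (hzx : z ≤ x) :
    ∑ p ∈ upTo U x \ upTo U z, Real.log p / p ≤ σ * (Real.log x - Real.log z) + 2 * C := by
  classical
  have h1 := h.abs_sub_le x (hz.trans hzx)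
  have h2 := h.abs_sub_le z hz
  have h3 := Finset.sum_sdiff (upTo_mono U hzx) (f := fun p : ℕ => Real.log p / p)
  rw [← logPrimeSum_eq, ← logPrimeSum_eq] at h3
  rw [abs_le] at h1 h2
  linarith

/-- Short ranges `(y / H, y]` contain many elements of `U`. -/
lemma exists_window (h : HasLogDensity U σ C) (hσ : 0 < σ) :
    ∃ H : ℝ, 1 < H ∧ ∀ y, H ≤ y → 1 ≤ ∑ p ∈ upTo U y \ upTo U (y / H), Real.log p / p := by
  have hC := h.nonneg
  have hpos : 0 < (1 + 2 * C) / σ := by positivity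
  -- Chosen so that `σ log H - 2C = 1`.
  refine ⟨Real.exp ((1 + 2 * C) / σ), Real.one_lt_exp_iff.2 hpos, fun y hy => ?_⟩
  have hH := Real.exp_pos ((1 + 2 * C) / σ)
  have hH1 := Real.one_lt_exp_iff.2 hpos
  have hy0 : 0 < y := hH.trans_le hy
  have h1 := h.sum_sdiff_ge (z := y / Real.exp ((1 + 2 * C) / σ)) (x := y)
    ((one_le_div hH).2 hy) (div_le_self hy0.le hH1.le)
  rw [Real.log_div hy0.ne' hH.ne', Real.log_exp] at h1
  have h2 : σ * (Real.log y - (Real.log y - (1 + 2 * C) / σ)) - 2 * C = 1 := by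
    field_simp; ring
  linarith

/-- A lower bound of Chebyshev's type. -/
lemma exists_sum_log_ge (h : HasLogDensity U σ C) (hσ : 0 < σ) :
    ∃ H : ℝ, 1 < H ∧ ∀ y, H ≤ y → y / H ≤ ∑ p ∈ upTo U y, Real.log p := by
  classical
  obtain ⟨H, hH, hw⟩ := h.exists_window hσ
  refine ⟨H, hH, fun y hy => ?_⟩
  have hyH : 0 < y / H := by have : 0 < y := by linarith
                             positivity
  have h1 := hw y hy
  calc y / H ≤ y / H * ∑ p ∈ upTo U y \ upTo U (y / H), Real.log p / p := by
        nlinarith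
    _ = ∑ p ∈ upTo U y \ upTo U (y / H), y / H * (Real.log p / p) := Finset.mul_sum ..
    _ ≤ ∑ p ∈ upTo U y \ upTo U (y / H), Real.log p := by
        refine Finset.sum_le_sum fun p hp => ?_
        rw [Finset.mem_sdiff, mem_upTo, mem_upTo] at hp
        have hp0 : (0 : ℝ) < p := by exact_mod_cast hp.1.1
        have h2 : y / H ≤ p := by
          by_contra hlt
          push Not at hlt
          exact hp.2 ⟨hp.1.1, hlt.le, hp.1.2.2⟩
        have h3 : 0 ≤ Real.log p := Real.log_natCast_nonneg _
        calc y / H * (Real.log p / p) ≤ p * (Real.log p / p) := by gcongr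
          _ = Real.log p := by field_simp
    _ ≤ _ := Finset.sum_le_sum_of_subset_of_nonneg Finset.sdiff_subset fun p _ _ =>
        Real.log_natCast_nonneg _

/-- A crude substitute for partial summation: on the range, `log p` is replaced by its largest value
(by its smallest in `recipSum_sub_le`). -/
lemma recipSum_sub_ge (h : HasLogDensity U σ C) {z x : ℝ} (hz : 1 ≤ z) (hzx : z ≤ x) (hx : 1 < x) :
    (σ * (Real.log x - Real.log z) - 2 * C) / Real.log x ≤ recipSum U x - recipSum U z := by
  classical
  have h1 := h.sum_sdiff_ge hz hzx
  have h3 := Finset.sum_sdiff (upTo_mono U hzx) (f := fun p : ℕ => 1 / (p : ℝ))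
  have h4 : recipSum U x - recipSum U z = ∑ p ∈ upTo U x \ upTo U z, 1 / (p : ℝ) := by
    rw [recipSum, recipSum]; linarith
  have hlx : 0 < Real.log x := Real.log_pos hx
  rw [h4, div_le_iff₀ hlx]
  refine h1.trans ?_
  rw [Finset.sum_mul]
  refine Finset.sum_le_sum fun p hp => ?_
  rw [Finset.mem_sdiff, mem_upTo] at hp
  have hp0 : (0 : ℝ) < p := by exact_mod_cast hp.1.1
  have h5 : Real.log p ≤ Real.log x := Real.log_le_log hp0 hp.1.2.1
  rw [div_eq_mul_one_div, mul_comm]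
  gcongr

lemma recipSum_sub_le (h : HasLogDensity U σ C) {z x : ℝ} (hz : 1 < z) (hzx : z ≤ x) :
    recipSum U x - recipSum U z ≤ (σ * (Real.log x - Real.log z) + 2 * C) / Real.log z := by
  classical
  have h1 := h.sum_sdiff_le hz.le hzx
  have h3 := Finset.sum_sdiff (upTo_mono U hzx) (f := fun p : ℕ => 1 / (p : ℝ))
  have h4 : recipSum U x - recipSum U z = ∑ p ∈ upTo U x \ upTo U z, 1 / (p : ℝ) := by
    rw [recipSum, recipSum]; linarith
  have hlz : 0 < Real.log z := Real.log_pos hz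
  rw [h4, le_div_iff₀ hlz]
  refine le_trans ?_ h1
  rw [Finset.sum_mul]
  refine Finset.sum_le_sum fun p hp => ?_
  rw [Finset.mem_sdiff, mem_upTo, mem_upTo] at hp
  have hp0 : (0 : ℝ) < p := by exact_mod_cast hp.1.1
  have h2 : z ≤ p := by
    by_contra hlt
    push Not at hlt
    exact hp.2 ⟨hp.1.1, hlt.le, hp.1.2.2⟩
  have h5 : Real.log z ≤ Real.log p := Real.log_le_log (by linarith) h2
  rw [div_eq_mul_one_div (Real.log (p : ℝ)), mul_comm]
  gcongr

lemma _root_.recipSum_mono (U : Set ℕ) : Monotone (recipSum U) := fun x y h =>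
  Finset.sum_le_sum_of_subset_of_nonneg (upTo_mono U h) fun p _ _ => by positivity

lemma _root_.recipSum_nonneg (U : Set ℕ) (x : ℝ) : 0 ≤ recipSum U x :=
  Finset.sum_nonneg fun p _ => by positivity

/-- Any power of `log x` is bounded by a power of `exp (∑ 1 / p)`. -/
lemma exists_log_pow_le (h : HasLogDensity U σ C) (hσ : 0 < σ) (k : ℕ) :
    ∃ (r : ℕ) (D : ℝ), 0 < D ∧ ∀ x, Real.exp 1 ≤ x →
      Real.log x ^ k ≤ D * Real.exp (r * recipSum U x) := by
  have hC := h.nonneg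
  -- With `σ K = 2σ + 2C`, each passage from `x` to `x ^ K` adds at least `d = σ / K` to the
  -- reciprocal sum. So this sum is at least `n d` once `log x ≥ K ^ n`.
  set K : ℝ := 2 + 2 * C / σ with hK
  have hK2 : 2 ≤ K := by
    have : 0 ≤ 2 * C / σ := by positivity
    linarith
  have hK0 : 0 < K := by linarith
  set d : ℝ := σ / K with hd
  have hd0 : 0 < d := by positivity
  have hstep : ∀ n : ℕ, n * d ≤ recipSum U (Real.exp (K ^ n)) := by
    intro n
    induction n with
    | zero => simpa using recipSum_nonneg U _
    | succ n ih =>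
      have hKn : 1 ≤ K ^ n := one_le_pow₀ (by linarith)
      have hKn1 : K ^ n ≤ K ^ (n + 1) := pow_le_pow_right₀ (by linarith) (by omega)
      have h1 := h.recipSum_sub_ge (z := Real.exp (K ^ n)) (x := Real.exp (K ^ (n + 1)))
        (Real.one_le_exp (by linarith)) (Real.exp_le_exp.2 hKn1)
        (Real.one_lt_exp_iff.2 (by linarith))
      rw [Real.log_exp, Real.log_exp] at h1
      have h2 : d ≤ (σ * (K ^ (n + 1) - K ^ n) - 2 * C) / K ^ (n + 1) := by
        rw [le_div_iff₀ (by positivity), hd, pow_succ]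
        have h3 : σ / K * (K ^ n * K) = σ * K ^ n := by field_simp
        rw [h3]
        have h4 : σ * K = 2 * σ + 2 * C := by rw [hK]; field_simp
        have h5 : σ * (K ^ n * K - K ^ n) = σ * K ^ n + 2 * C * K ^ n := by
          linear_combination K ^ n * h4
        rw [h5]
        nlinarith
      push_cast
      linarith
  obtain ⟨r, hr⟩ := exists_nat_ge (k * Real.log K / d)
  have hlogK : 0 < Real.log K := Real.log_pos (by linarith)
  refine ⟨r, K ^ k, by positivity, fun x hx => ?_⟩
  have hlx : 1 ≤ Real.log x := by
    rw [← Real.log_exp 1]; exact Real.log_le_log (Real.exp_pos _) hx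
  have hx0 : 0 < x := (Real.exp_pos 1).trans_le hx
  obtain ⟨n, hn1, hn2⟩ := exists_nat_pow_near hlx (by linarith : 1 < K)
  have h1 : n * d ≤ recipSum U x := by
    refine (hstep n).trans (recipSum_mono U ?_)
    rw [← Real.exp_log hx0]
    exact Real.exp_le_exp.2 hn1
  have h2 : (K ^ n) ^ k ≤ Real.exp (r * recipSum U x) := by
    rw [← Real.exp_log (by positivity : 0 < (K ^ n) ^ k)]
    apply Real.exp_le_exp.2
    rw [Real.log_pow, Real.log_pow]
    rw [div_le_iff₀ hd0] at hr
    calc (k : ℝ) * (n * Real.log K) = n * (k * Real.log K) := by ring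
      _ ≤ n * (r * d) := by gcongr
      _ = r * (n * d) := by ring
      _ ≤ _ := by gcongr
  calc Real.log x ^ k ≤ (K ^ (n + 1)) ^ k := by gcongr
    _ = K ^ k * (K ^ n) ^ k := by rw [pow_succ, mul_pow, mul_comm]
    _ ≤ _ := by gcongr

end HasLogDensity

/-! ### A lower bound for the counting function of the semigroup -/

/-- Sieving one prime at a time: the terms lost to `p` have the form `k = p l` with `l` still in the
sum, so at most a proportion `1 / p` is lost. -/
lemma prod_one_sub_mul_sum_le (F : Finset ℕ) (hF : ∀ p ∈ F, p.Prime) (N : ℕ) :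
    (∏ p ∈ F, (1 - 1 / (p : ℝ))) * ∑ k ∈ Finset.Icc 1 N, 1 / (k : ℝ)
      ≤ ∑ k ∈ Finset.Icc 1 N with ∀ p ∈ F, ¬ p ∣ k, 1 / (k : ℝ) := by
  classical
  induction F using Finset.induction_on with
  | empty => simp
  | insert p F hpF ih =>
    have ih := ih fun q hq => hF q (Finset.mem_insert_of_mem hq)
    have hp := hF p (Finset.mem_insert_self _ _)
    have hp2 : (2 : ℝ) ≤ p := by exact_mod_cast hp.two_le
    set G := ∑ k ∈ Finset.Icc 1 N with ∀ q ∈ F, ¬ q ∣ k, 1 / (k : ℝ) with hG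
    have h1 : G = ∑ k ∈ Finset.Icc 1 N with ∀ q ∈ insert p F, ¬ q ∣ k, 1 / (k : ℝ) +
        ∑ k ∈ (Finset.Icc 1 N).filter (fun k => ∀ q ∈ F, ¬ q ∣ k) with p ∣ k, 1 / (k : ℝ) := by
      rw [hG, ← Finset.sum_filter_add_sum_filter_not _ (fun k => ¬ p ∣ k)]
      congr 1
      · refine Finset.sum_congr ?_ fun _ _ => rfl
        ext k
        simp only [Finset.mem_filter, Finset.forall_mem_insert]
        tauto
      · simp only [not_not]
    have h2 : ∑ k ∈ (Finset.Icc 1 N).filter (fun k => ∀ q ∈ F, ¬ q ∣ k) with p ∣ k, 1 / (k : ℝ)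
        ≤ 1 / p * G := by
      have h3 : (Finset.filter (fun k => p ∣ k) ((Finset.Icc 1 N).filter (fun k => ∀ q ∈ F, ¬ q ∣ k)))
          ⊆ ((Finset.Icc 1 N).filter (fun k => ∀ q ∈ F, ¬ q ∣ k)).image (fun k => p * k) := by
        intro k hk
        simp only [Finset.mem_filter, Finset.mem_Icc] at hk
        obtain ⟨⟨⟨h1, h2⟩, h3⟩, l, rfl⟩ := hk
        rw [Finset.mem_image]
        refine ⟨l, ?_, rfl⟩
        simp only [Finset.mem_filter, Finset.mem_Icc]
        have hl : 1 ≤ l := Nat.pos_of_ne_zero (by rintro rfl; simp at h1)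
        have hle : l ≤ p * l := Nat.le_mul_of_pos_left l hp.pos
        exact ⟨⟨hl, hle.trans h2⟩, fun q hq hql => h3 q hq (hql.mul_left p)⟩
      calc _ ≤ ∑ k ∈ ((Finset.Icc 1 N).filter (fun k => ∀ q ∈ F, ¬ q ∣ k)).image (fun k => p * k),
            1 / (k : ℝ) := Finset.sum_le_sum_of_subset_of_nonneg h3 fun _ _ _ => by positivity
        _ = ∑ k ∈ (Finset.Icc 1 N).filter (fun k => ∀ q ∈ F, ¬ q ∣ k), 1 / ((p * k : ℕ) : ℝ) := by
            rw [Finset.sum_image]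
            intro a _ b _ hab
            exact Nat.eq_of_mul_eq_mul_left hp.pos hab
        _ = 1 / p * G := by
            rw [hG, Finset.mul_sum]
            refine Finset.sum_congr rfl fun k _ => ?_
            push_cast; rw [one_div_mul_one_div]
    have h4 : (1 - 1 / (p : ℝ)) * G ≤
        ∑ k ∈ Finset.Icc 1 N with ∀ q ∈ insert p F, ¬ q ∣ k, 1 / (k : ℝ) := by linarith
    rw [Finset.prod_insert hpF, mul_assoc]
    refine le_trans ?_ h4
    have h5 : 0 ≤ 1 - 1 / (p : ℝ) := by
      rw [sub_nonneg, div_le_one (by linarith)]; linarith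
    gcongr

/-- Here `1 - 1/p ≥ exp(-1/(p-1))`, and `1/(p-1)` exceeds `1/p` by the summable `1/(p(p-1))`. -/
lemma exp_le_prod_one_sub (F : Finset ℕ) (hF : ∀ p ∈ F, 2 ≤ p) :
    Real.exp (-(∑ p ∈ F, 1 / (p : ℝ)) - 1) ≤ ∏ p ∈ F, (1 - 1 / (p : ℝ)) := by
  have h1 : ∀ p ∈ F, Real.exp (-(1 / (p : ℝ)) - 1 / ((p : ℝ) * (p - 1))) ≤ 1 - 1 / (p : ℝ) := by
    intro p hp
    have hp2 : (2 : ℝ) ≤ p := by exact_mod_cast hF p hp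
    have hp1 : (0 : ℝ) < p - 1 := by linarith
    have h2 : -(1 / (p : ℝ)) - 1 / ((p : ℝ) * (p - 1)) = -(1 / (p - 1)) := by field_simp; ring
    have h3 := Real.add_one_le_exp (1 / ((p : ℝ) - 1))
    rw [h2, Real.exp_neg]
    rw [inv_le_comm₀ (Real.exp_pos _) (by rw [sub_pos, div_lt_one (by linarith)]; linarith)]
    refine le_trans (le_of_eq ?_) h3
    field_simp; ring
  have h2 := sum_one_div_mul_sub_one_le F hF
  calc _ ≤ Real.exp (∑ p ∈ F, (-(1 / (p : ℝ)) - 1 / ((p : ℝ) * (p - 1)))) := by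
        apply Real.exp_le_exp.2
        rw [Finset.sum_sub_distrib, Finset.sum_neg_distrib]; linarith
    _ = ∏ p ∈ F, Real.exp (-(1 / (p : ℝ)) - 1 / ((p : ℝ) * (p - 1))) := Real.exp_sum _ _
    _ ≤ _ := Finset.prod_le_prod (fun _ _ => (Real.exp_pos _).le) h1

/-- The semigroup is closed under multiplication by `p ∈ T`, and `(m, p) ↦ (m p, p)` is injective;
each product `n` then collects at most `log n`. -/
lemma sum_sum_log_le (T : Set ℕ) (hT : ∀ p ∈ T, p.Prime) (x : ℝ) :
    ∑ m ∈ upTo (primeSemigroup T) x, ∑ p ∈ upTo T (x / m), Real.log p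
      ≤ (upTo (primeSemigroup T) x).card * Real.log x := by
  classical
  have h1 : ∑ n ∈ upTo (primeSemigroup T) x, ∑ p ∈ upTo T x with p ∣ n, Real.log p
      ≤ (upTo (primeSemigroup T) x).card * Real.log x := by
    rw [← nsmul_eq_mul]
    apply Finset.sum_le_card_nsmul
    intro n hn
    rw [mem_upTo] at hn
    have hn0 : (0 : ℝ) < n := by exact_mod_cast hn.1
    exact (sum_log_dvd_le _ (fun p hp => hT p (mem_upTo.1 hp).2.2) hn.1).trans
      (Real.log_le_log hn0 hn.2.1)
  refine le_trans ?_ h1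
  rw [Finset.sum_sigma', Finset.sum_sigma']
  set I := (upTo (primeSemigroup T) x).sigma fun m => upTo T (x / m) with hI
  set g : (_ : ℕ) × ℕ → (_ : ℕ) × ℕ := fun z => ⟨z.1 * z.2, z.2⟩ with hg
  have hinj : Set.InjOn g I := by
    rintro ⟨m, p⟩ hz ⟨m', p'⟩ hz' h
    simp only [hg, Sigma.mk.injEq, heq_eq_eq] at h
    obtain ⟨h1, rfl⟩ := h
    have hp := (mem_upTo.1 (Finset.mem_sigma.1 (Finset.mem_coe.1 hz)).2).1
    simp only at hp
    rw [Nat.eq_of_mul_eq_mul_right hp h1]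
  have h2 : ∑ z ∈ I, Real.log (z.2 : ℝ) = ∑ z ∈ I.image g, Real.log (z.2 : ℝ) := by
    rw [Finset.sum_image hinj]
  rw [h2]
  apply Finset.sum_le_sum_of_subset_of_nonneg
  · intro z hz
    obtain ⟨⟨m, p⟩, hmp, rfl⟩ := Finset.mem_image.1 hz
    rw [hI, Finset.mem_sigma, mem_upTo, mem_upTo] at hmp
    simp only at hmp
    obtain ⟨⟨hm0, hmx, hmQ⟩, hp0, hpx, hpT⟩ := hmp
    have hm0' : (0 : ℝ) < m := by exact_mod_cast hm0
    rw [le_div_iff₀ hm0'] at hpx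
    simp only [hg, Finset.mem_sigma, Finset.mem_filter, mem_upTo]
    refine ⟨⟨Nat.mul_pos hm0 hp0, by push_cast; linarith, Nat.mul_pos hm0 hp0, ?_⟩,
      ⟨hp0, ?_, hpT⟩, dvd_mul_left _ _⟩
    · intro q hq hqd
      rcases hq.dvd_mul.1 hqd with h | h
      · exact hmQ.2 q hq h
      · rwa [(Nat.prime_dvd_prime_iff_eq hq (hT p hpT)).1 h]
    · have : (1 : ℝ) ≤ m := by exact_mod_cast hm0
      have hp0' : (0 : ℝ) < p := by exact_mod_cast hp0
      nlinarith
  · intro z _ _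
    exact Real.log_natCast_nonneg _

/-- A lower bound for the counting function of the semigroup generated by `T`. -/
theorem HasLogDensity.exists_le_card_primeSemigroup {T : Set ℕ} {τ C : ℝ}
    (h : HasLogDensity T τ C) (hτ : 0 < τ) :
    ∃ c X : ℝ, 0 < c ∧ ∀ x, X ≤ x →
      c * x * Real.exp (-recipSum {p | p.Prime ∧ p ∉ T} x)
        ≤ (upTo (primeSemigroup T) x).card := by
  classical
  obtain ⟨H, hH, hθ⟩ := h.exists_sum_log_ge hτ
  have hH0 : 0 < H := by linarith
  refine ⟨Real.exp (-1) / (2 * H), H ^ 2, by positivity, fun x hx => ?_⟩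
  have hx1 : 1 < x := by nlinarith
  have hx0 : 0 < x := by linarith
  have hlx : 0 < Real.log x := Real.log_pos hx1
  set S : Set ℕ := {p | p.Prime ∧ p ∉ T} with hS
  set Q := upTo (primeSemigroup T) x with hQ
  have hHx : H ≤ x / H := by rw [le_div_iff₀ hH0]; nlinarith
  have h1 := sum_sum_log_le T h.prime x
  -- For `m ≤ x / H` the Chebyshev bound applies at `x / m ≥ H`. The sum of `1 / m` is then bounded
  -- below by sieving the harmonic sum by the primes outside `T`, and its logarithm cancels the one
  -- in `h1`.
  have h2 : x / H * ∑ m ∈ upTo (primeSemigroup T) (x / H), 1 / (m : ℝ)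
      ≤ ∑ m ∈ Q, ∑ p ∈ upTo T (x / m), Real.log p := by
    calc _ = ∑ m ∈ upTo (primeSemigroup T) (x / H), x / H * (1 / (m : ℝ)) := Finset.mul_sum ..
      _ ≤ ∑ m ∈ upTo (primeSemigroup T) (x / H), ∑ p ∈ upTo T (x / m), Real.log p := by
        refine Finset.sum_le_sum fun m hm => ?_
        rw [mem_upTo] at hm
        have hm0 : (0 : ℝ) < m := by exact_mod_cast hm.1
        have h3 : H ≤ x / m := by
          rw [le_div_iff₀ hm0]
          have := (le_div_iff₀ hH0).1 hm.2.1
          linarith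
        refine le_trans (le_of_eq ?_) (hθ _ h3)
        field_simp
      _ ≤ _ := by
        apply Finset.sum_le_sum_of_subset_of_nonneg (upTo_mono _ (div_le_self hx0.le hH.le))
        intro m _ _
        exact Finset.sum_nonneg fun p _ => Real.log_natCast_nonneg _
  have h3 : Real.exp (-recipSum S x - 1) * Real.log (x / H)
      ≤ ∑ m ∈ upTo (primeSemigroup T) (x / H), 1 / (m : ℝ) := by
    have h4 := prod_one_sub_mul_sum_le (upTo S x) (fun p hp => (mem_upTo.1 hp).2.2.1) ⌊x / H⌋₊
    have h5 := exp_le_prod_one_sub (upTo S x) (fun p hp => (mem_upTo.1 hp).2.2.1.two_le)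
    have h6 : Real.log (x / H) ≤ ∑ k ∈ Finset.Icc 1 ⌊x / H⌋₊, 1 / (k : ℝ) := by
      have h7 := log_le_harmonic_floor (x / H) (by positivity)
      rw [harmonic_eq_sum_Icc] at h7
      push_cast at h7
      simpa only [one_div] using h7
    have h8 : 0 ≤ Real.log (x / H) := Real.log_nonneg (by linarith)
    calc _ ≤ (∏ p ∈ upTo S x, (1 - 1 / (p : ℝ))) * ∑ k ∈ Finset.Icc 1 ⌊x / H⌋₊, 1 / (k : ℝ) := by
          apply mul_le_mul h5 h6 h8 ((Real.exp_pos _).le.trans h5)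
      _ ≤ _ := h4
      _ ≤ _ := by
        apply Finset.sum_le_sum_of_subset_of_nonneg _ fun _ _ _ => by positivity
        intro k hk
        rw [Finset.mem_filter, Finset.mem_Icc] at hk
        obtain ⟨⟨hk1, hk2⟩, hk3⟩ := hk
        have hkx : (k : ℝ) ≤ x / H := (Nat.le_floor_iff' (by omega)).1 hk2
        rw [mem_upTo]
        refine ⟨hk1, hkx, hk1, fun p hp hpk => ?_⟩
        by_contra hpT
        apply hk3 p _ hpk
        rw [mem_upTo]
        refine ⟨hp.pos, ?_, hp, hpT⟩
        have h9 : (p : ℝ) ≤ k := by exact_mod_cast Nat.le_of_dvd hk1 hpk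
        exact h9.trans (hkx.trans (div_le_self hx0.le hH.le))
  have h4 : Real.log x / 2 ≤ Real.log (x / H) := by
    have h5 := Real.log_le_log (by positivity) hx
    rw [Real.log_pow] at h5
    push_cast at h5
    rw [Real.log_div hx0.ne' hH0.ne']
    linarith
  have h5 : x / H * (Real.exp (-recipSum S x - 1) * (Real.log x / 2)) ≤ Q.card * Real.log x := by
    refine le_trans ?_ (h2.trans h1)
    gcongr
    refine le_trans ?_ h3
    gcongr
  have h6 : (Real.exp (-1) / (2 * H) * x * Real.exp (-recipSum S x)) * Real.log x
      ≤ Q.card * Real.log x := by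
    refine le_trans (le_of_eq ?_) h5
    have h7 : -recipSum S x - 1 = -recipSum S x + -1 := by ring
    rw [h7, Real.exp_add]
    field_simp
  exact le_of_mul_le_mul_right h6 hlx

/-! ### Rankin's method and the upper bound sieve -/

/-- The cost of the Rankin weight `p ^ (1/ℓ)`: since `exp t ≤ 1 + 2t` on `[0, 1]`, a factor grows by
at most `exp(2 t r / p)`, where `t = log p / ℓ`. -/
lemma prod_one_add_rpow_le (P : Finset ℕ) (hP : ∀ p ∈ P, 1 ≤ p) (r : ℝ) (hr : 0 ≤ r) (ℓ : ℝ)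
    (hℓ : 0 < ℓ) (hPℓ : ∀ p ∈ P, Real.log p ≤ ℓ) :
    ∏ p ∈ P, (1 + r / p * Real.exp (Real.log p / ℓ))
      ≤ (∏ p ∈ P, (1 + r / (p : ℝ))) * Real.exp (2 * r * (∑ p ∈ P, Real.log p / p) / ℓ) := by
  have h1 : Real.exp (2 * r * (∑ p ∈ P, Real.log p / p) / ℓ)
      = ∏ p ∈ P, Real.exp (r / p * (2 * (Real.log p / ℓ))) := by
    rw [← Real.exp_sum]
    congr 1
    rw [Finset.mul_sum, Finset.sum_div]
    refine Finset.sum_congr rfl fun p _ => ?_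
    ring
  rw [h1, ← Finset.prod_mul_distrib]
  apply Finset.prod_le_prod
  · intro p _; positivity
  · intro p hp
    set t := Real.log p / ℓ with ht
    have hp0 : (0 : ℝ) < p := by exact_mod_cast hP p hp
    have ht0 : 0 ≤ t := div_nonneg (Real.log_natCast_nonneg _) hℓ.le
    have ht1 : t ≤ 1 := (div_le_one hℓ).2 (hPℓ p hp)
    have h2 : Real.exp t ≤ 1 + 2 * t := by
      have := Real.abs_exp_sub_one_le (x := t) (by rwa [abs_of_nonneg ht0])
      rw [abs_of_nonneg ht0] at this
      have := (abs_le.1 this).2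
      linarith
    set w := r / (p : ℝ) with hw
    have hw0 : 0 ≤ w := by positivity
    have h3 := Real.add_one_le_exp (w * (2 * t))
    calc 1 + w * Real.exp t ≤ 1 + w * (1 + 2 * t) := by gcongr
      _ ≤ (1 + w) * (w * (2 * t) + 1) := by nlinarith [mul_nonneg hw0 (mul_nonneg hw0 ht0)]
      _ ≤ _ := by gcongr

/-- Rankin's method: the sum over squarefree `q ≤ Y` is at least half of the full product. -/
lemma half_prod_le_sum (P : Finset ℕ) (hP : ∀ p ∈ P, 1 ≤ p) (r : ℝ) (hr : 0 ≤ r) (ℓ : ℝ)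
    (hℓ : 0 < ℓ) (hPℓ : ∀ p ∈ P, Real.log p ≤ ℓ) (Y : ℝ) (hY : 0 < Y)
    (hYℓ : 2 * r * (∑ p ∈ P, Real.log p / p) + ℓ ≤ Real.log Y) :
    (∏ p ∈ P, (1 + r / (p : ℝ))) / 2
      ≤ ∑ s ∈ P.powerset with ((∏ p ∈ s, p : ℕ) : ℝ) ≤ Y, ∏ p ∈ s, r / (p : ℝ) := by
  classical
  have h1 : ∏ p ∈ P, (1 + r / (p : ℝ)) = ∑ s ∈ P.powerset, ∏ p ∈ s, r / (p : ℝ) :=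
    Finset.prod_one_add P
  have h2 := Finset.sum_filter_add_sum_filter_not P.powerset
    (fun s => ((∏ p ∈ s, p : ℕ) : ℝ) ≤ Y) (fun s => ∏ p ∈ s, r / (p : ℝ))
  -- Each `q > Y` is weighted by `(q / Y) ^ (1/ℓ) ≥ 1`; `hYℓ` then makes the tail at most `exp(-1) <
  -- 1/2` of the product.
  have h3 : ∑ s ∈ P.powerset with ¬ ((∏ p ∈ s, p : ℕ) : ℝ) ≤ Y, ∏ p ∈ s, r / (p : ℝ)
      ≤ ∑ s ∈ P.powerset, Real.exp (-(Real.log Y / ℓ)) *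
        ∏ p ∈ s, (r / p * Real.exp (Real.log p / ℓ)) := by
    refine le_trans (Finset.sum_le_sum fun s hs => ?_)
      (Finset.sum_le_sum_of_subset_of_nonneg (Finset.filter_subset _ _) fun s _ _ => ?_)
    · rw [Finset.mem_filter, Finset.mem_powerset, not_le] at hs
      have hlog : Real.log Y ≤ ∑ p ∈ s, Real.log p := by
        rw [← Real.log_prod fun p hp => by
          have := hP p (hs.1 hp)
          positivity]
        apply Real.log_le_log hY
        have := hs.2.le
        rwa [Nat.cast_prod] at this
      rw [Finset.prod_mul_distrib, ← Real.exp_sum, ← Finset.sum_div, mul_left_comm, ← Real.exp_add]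
      apply le_mul_of_one_le_right
      · exact Finset.prod_nonneg fun p _ => by positivity
      · apply Real.one_le_exp
        have : Real.log Y / ℓ ≤ (∑ p ∈ s, Real.log p) / ℓ := by gcongr
        linarith
    · have : 0 ≤ ∏ p ∈ s, (r / p * Real.exp (Real.log (p : ℝ) / ℓ)) :=
        Finset.prod_nonneg fun p _ => by positivity
      positivity
  rw [← Finset.mul_sum, ← Finset.prod_one_add] at h3
  have h4 := prod_one_add_rpow_le P hP r hr ℓ hℓ hPℓ
  set G := ∏ p ∈ P, (1 + r / (p : ℝ)) with hG
  have hG0 : 0 ≤ G := Finset.prod_nonneg fun p _ => by positivity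
  have h5 : ∑ s ∈ P.powerset with ¬ ((∏ p ∈ s, p : ℕ) : ℝ) ≤ Y, ∏ p ∈ s, r / (p : ℝ) ≤ G / 2 := by
    calc _ ≤ _ := h3
      _ ≤ Real.exp (-(Real.log Y / ℓ)) * (G * Real.exp (2 * r * (∑ p ∈ P, Real.log p / p) / ℓ)) := by
        gcongr
      _ = G * Real.exp (2 * r * (∑ p ∈ P, Real.log p / p) / ℓ - Real.log Y / ℓ) := by
        rw [sub_eq_add_neg, Real.exp_add]; ring
      _ ≤ G * Real.exp (-1) := by
        gcongr
        rw [← sub_div, div_le_iff₀ hℓ]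
        linarith
      _ ≤ G * (1 / 2) := by
        gcongr
        have := Real.exp_one_gt_d9
        rw [Real.exp_neg, one_div]
        exact inv_anti₀ (by norm_num) (by linarith)
      _ = G / 2 := by ring
  linarith

/-- With `w = r / p`: `log(1 + w) ≥ w/(1 + w) ≥ w - w²`, and the `w²` sum to at most `r²`. -/
lemma exp_le_prod_one_add (P : Finset ℕ) (hP : ∀ p ∈ P, 2 ≤ p) (r : ℝ) (hr : 0 ≤ r) :
    Real.exp (r * (∑ p ∈ P, 1 / (p : ℝ)) - r ^ 2) ≤ ∏ p ∈ P, (1 + r / (p : ℝ)) := by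
  have h1 : ∀ p ∈ P, Real.exp (r * (1 / (p : ℝ)) - r ^ 2 * (1 / ((p : ℝ) * (p - 1))))
      ≤ 1 + r / (p : ℝ) := by
    intro p hp
    have hp2 : (2 : ℝ) ≤ p := by exact_mod_cast hP p hp
    have hp1 : (0 : ℝ) < p - 1 := by linarith
    set w := r / (p : ℝ) with hw
    have hw0 : 0 ≤ w := by positivity
    have h2 : r * (1 / (p : ℝ)) - r ^ 2 * (1 / ((p : ℝ) * (p - 1))) ≤ w / (1 + w) := by
      have h3 : w ^ 2 ≤ r ^ 2 * (1 / ((p : ℝ) * (p - 1))) := by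
        rw [hw, div_pow, mul_one_div]
        gcongr
        nlinarith
      have h4 : r * (1 / (p : ℝ)) = w := by rw [hw]; ring
      rw [h4, le_div_iff₀ (by positivity)]
      have h5 : 0 ≤ w * w ^ 2 := by positivity
      have h6 := mul_le_mul_of_nonneg_right h3 (by positivity : 0 ≤ 1 + w)
      nlinarith
    have h3 := Real.add_one_le_exp (-(w / (1 + w)))
    have h4 : -(w / (1 + w)) + 1 = (1 + w)⁻¹ := by field_simp; ring
    rw [h4, Real.exp_neg, inv_le_inv₀ (by positivity) (Real.exp_pos _)] at h3
    exact (Real.exp_le_exp.2 h2).trans h3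
  have h2 := sum_one_div_mul_sub_one_le P hP
  calc _ ≤ Real.exp (∑ p ∈ P, (r * (1 / (p : ℝ)) - r ^ 2 * (1 / ((p : ℝ) * (p - 1))))) := by
        apply Real.exp_le_exp.2
        rw [Finset.sum_sub_distrib, ← Finset.mul_sum, ← Finset.mul_sum]
        have := mul_le_mul_of_nonneg_left h2 (sq_nonneg r)
        linarith
    _ = ∏ p ∈ P, Real.exp (r * (1 / (p : ℝ)) - r ^ 2 * (1 / ((p : ℝ) * (p - 1)))) :=
        Real.exp_sum _ _
    _ ≤ _ := Finset.prod_le_prod (fun _ _ => (Real.exp_pos _).le) h1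

/-- An upper bound sieve: if `A + B` avoids the multiples of the primes of `U`, with `B` a fixed
finite set, then `A` is sparse. -/
theorem HasLogDensity.exists_card_le {U : Set ℕ} {σ C : ℝ} (h : HasLogDensity U σ C)
    (hσ : 0 < σ) (B : Finset ℕ) :
    ∃ D X : ℝ, 0 < D ∧ ∀ x, X ≤ x → ∀ A : Finset ℕ, (∀ a ∈ A, (a : ℝ) ≤ x) →
      (∀ p ∈ U, ∀ a ∈ A, ∀ b ∈ B, ¬ p ∣ a + b) →
      (A.card : ℝ) ≤ D * x * Real.exp (-(B.card * recipSum U x)) := by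
  classical
  have hC := h.nonneg
  set r : ℕ := B.card with hr
  -- For `p ≥ r₀` the elements of `B` are distinct modulo `p`.
  set r₀ : ℕ := B.sup id + 1 with hr₀
  -- `z = x ^ (1 / u)`
  set u : ℝ := 4 * r * (σ + C) + 2 with hu
  have hu2 : 2 ≤ u := by
    have : 0 ≤ 4 * (r : ℝ) * (σ + C) := by positivity
    linarith
  have hu0 : 0 < u := by linarith
  set E : ℝ := u * (σ + 2 * C) with hE
  set D : ℝ := Real.exp (4 * Real.pi) * 4 * Real.exp (r * (E + r₀) + r ^ 2) with hD
  refine ⟨D, Real.exp u, by positivity, fun x hx A hA hAB => ?_⟩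
  have hx0 : 0 < x := (Real.exp_pos _).trans_le hx
  have hlx : u ≤ Real.log x := by
    rw [← Real.log_exp u]; exact Real.log_le_log (Real.exp_pos _) hx
  have hlx0 : 0 < Real.log x := by linarith
  have hx1 : 1 ≤ x := (Real.one_le_exp hu0.le).trans hx
  set ℓ : ℝ := Real.log x / u with hℓ
  have hℓ1 : 1 ≤ ℓ := (one_le_div hu0).2 hlx
  have hℓ0 : 0 < ℓ := by linarith
  set z : ℝ := Real.exp ℓ with hz
  have hzx : z ≤ x := by
    rw [← Real.exp_log hx0]
    exact Real.exp_le_exp.2 (div_le_self hlx0.le (by linarith))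
  have hz1 : 1 < z := Real.one_lt_exp_iff.2 hℓ0
  set P : Finset ℕ := (upTo U z).filter (fun p => r₀ ≤ p) with hPdef
  have hPz : P ⊆ upTo U z := Finset.filter_subset _ _
  have hPprime : ∀ p ∈ P, p.Prime := fun p hp => h.prime p (mem_upTo.1 (hPz hp)).2.2
  set Y : ℝ := Real.sqrt x with hY
  have hlogY : Real.log Y = Real.log x / 2 := by rw [hY, Real.log_sqrt hx0.le]
  have hsumP : ∑ p ∈ P, Real.log p / p ≤ (σ + C) * ℓ := by
    have h1 : ∑ p ∈ P, Real.log p / p ≤ logPrimeSum U z :=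
      Finset.sum_le_sum_of_subset_of_nonneg hPz fun p _ _ => log_natCast_div_nonneg p
    have h2 := (abs_le.1 (h.abs_sub_le z hz1.le)).2
    rw [hz, Real.log_exp, ← hz] at h2
    nlinarith
  -- The value of `u` makes `log Y = u ℓ / 2` equal to `2 r (σ + C) ℓ + ℓ`, as Rankin's method
  -- demands.
  have hmain := half_prod_le_sum P (fun p hp => (hPprime p hp).one_lt.le) r (by positivity) ℓ hℓ0
    (fun p hp => by
      have h1 := mem_upTo.1 (hPz hp)
      have h2 : (0 : ℝ) < p := by exact_mod_cast h1.1
      have := Real.log_le_log h2 h1.2.1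
      rwa [hz, Real.log_exp] at this) Y (Real.sqrt_pos.2 hx0) (by
      have h1 : Real.log x = u * ℓ := by rw [hℓ]; field_simp
      rw [hlogY, h1, hu]
      have h2 : 2 * (r : ℝ) * ∑ p ∈ P, Real.log p / p ≤ 2 * r * ((σ + C) * ℓ) :=
        mul_le_mul_of_nonneg_left hsumP (mul_nonneg zero_le_two (Nat.cast_nonneg r))
      linarith)
  have hprod := exp_le_prod_one_add P (fun p hp => (hPprime p hp).two_le) r (by positivity)
  set M : ℕ := ⌊x⌋₊ + 1 with hM
  have hxM : x ≤ M := by rw [hM]; push_cast; exact (Nat.lt_floor_add_one x).le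
  have hM2 : (M : ℝ) ≤ 2 * x := by
    rw [hM]; push_cast
    have := Nat.floor_le hx0.le
    linarith
  have hres : ∀ p ∈ P, residueCount B p = r := by
    intro p hp
    apply residueCount_eq_card
    intro b hb
    have h1 := Finset.le_sup (f := id) hb
    have h2 := (Finset.mem_filter.1 hp).2
    simp only [id] at h1
    omega
  have hls := large_sieve_sumset A B M
    (fun n hn => Nat.lt_succ_of_le (Nat.le_floor (hA n hn)))
    (P.powerset.filter fun s => ((∏ p ∈ s, p : ℕ) : ℝ) ≤ Y)
    (fun s hs p hp => by
      have hpP := Finset.mem_powerset.1 (Finset.mem_filter.1 hs).1 hp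
      exact ⟨hPprime p hpP, hAB p (mem_upTo.1 (hPz hpP)).2.2⟩)
    (fun s hs => by
      have h1 := (Finset.mem_filter.1 hs).2
      have h2 : ((∏ p ∈ s, p : ℕ) : ℝ) ^ 2 ≤ M := by
        calc _ ≤ Y ^ 2 := by gcongr
          _ = x := Real.sq_sqrt hx0.le
          _ ≤ M := hxM
      exact_mod_cast h2)
  have hcongr : ∑ s ∈ P.powerset with ((∏ p ∈ s, p : ℕ) : ℝ) ≤ Y,
      ∏ p ∈ s, ((residueCount B p : ℝ) / p)
      = ∑ s ∈ P.powerset with ((∏ p ∈ s, p : ℕ) : ℝ) ≤ Y, ∏ p ∈ s, ((r : ℝ) / p) := by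
    refine Finset.sum_congr rfl fun s hs => Finset.prod_congr rfl fun p hp => ?_
    rw [hres p (Finset.mem_powerset.1 (Finset.mem_filter.1 hs).1 hp)]
  rw [hcongr] at hls
  have hV1 : recipSum U z - r₀ ≤ ∑ p ∈ P, 1 / (p : ℝ) := by
    have h1 := Finset.sum_filter_add_sum_filter_not (upTo U z) (fun p => r₀ ≤ p)
      (fun p : ℕ => 1 / (p : ℝ))
    have h2 : ∑ p ∈ upTo U z with ¬ r₀ ≤ p, 1 / (p : ℝ) ≤ r₀ := by
      calc ∑ p ∈ upTo U z with ¬ r₀ ≤ p, 1 / (p : ℝ)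
          ≤ ∑ p ∈ upTo U z with ¬ r₀ ≤ p, (1 : ℝ) := by
            refine Finset.sum_le_sum fun p hp => ?_
            have h3 := (mem_upTo.1 (Finset.mem_filter.1 hp).1).1
            rw [div_le_one (by positivity)]
            exact_mod_cast h3
        _ ≤ ∑ p ∈ Finset.range r₀, (1 : ℝ) := by
            apply Finset.sum_le_sum_of_subset_of_nonneg
            · intro p hp
              rw [Finset.mem_range]
              exact not_le.1 (Finset.mem_filter.1 hp).2
            · intros; exact zero_le_one
        _ = r₀ := by simp
    rw [recipSum]
    linarith
  -- Sieving only up to `z = x ^ (1/u)` loses a bounded factor.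
  have hV2 : recipSum U x - recipSum U z ≤ E := by
    refine (h.recipSum_sub_le hz1 hzx).trans ?_
    rw [hz, Real.log_exp, div_le_iff₀ hℓ0, hE]
    have h1 : Real.log x = u * ℓ := by rw [hℓ]; field_simp
    rw [h1]
    have h2 : 2 * C ≤ u * (2 * C) * ℓ := by
      have : 1 ≤ u * ℓ := by nlinarith
      nlinarith
    nlinarith
  have hlow : Real.exp (r * recipSum U x - (r * (E + r₀) + r ^ 2)) / 2
      ≤ ∑ s ∈ P.powerset with ((∏ p ∈ s, p : ℕ) : ℝ) ≤ Y, ∏ p ∈ s, ((r : ℝ) / p) := by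
    refine le_trans ?_ hmain
    gcongr
    refine le_trans (Real.exp_le_exp.2 ?_) hprod
    have h1 : recipSum U x - (E + r₀) ≤ ∑ p ∈ P, 1 / (p : ℝ) := by linarith
    have h2 := mul_le_mul_of_nonneg_left h1 (Nat.cast_nonneg (α := ℝ) r)
    linarith
  have hfin : A.card * (Real.exp (r * recipSum U x - (r * (E + r₀) + r ^ 2)) / 2)
      ≤ Real.exp (4 * Real.pi) * (2 * x) := by
    calc _ ≤ _ := mul_le_mul_of_nonneg_left hlow (Nat.cast_nonneg _)
      _ ≤ _ := hls
      _ ≤ _ := by gcongr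
  rw [Real.exp_sub] at hfin
  rw [hD, Real.exp_neg]
  have he1 := Real.exp_pos (r * recipSum U x)
  have he2 := Real.exp_pos (r * (E + r₀) + (r : ℝ) ^ 2)
  rw [div_div, mul_div_assoc', div_le_iff₀ (by positivity)] at hfin
  rw [← div_eq_mul_inv, le_div_iff₀ he1]
  refine hfin.trans (le_of_eq ?_)
  ring

/-! ### Elementary consequences of a decomposition -/

lemma countingFn_eq_card_upTo {A : Set ℕ} (hA : ∀ a ∈ A, 0 < a) (x : ℝ) :
    countingFn A x = (upTo A x).card := by
  rw [countingFn, ← Set.ncard_coe_finset]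
  congr 1
  ext n
  rw [Finset.mem_coe, mem_upTo]
  exact ⟨fun h => ⟨hA n h.1, h.2, h.1⟩, fun h => ⟨h.2.2, h.2.1⟩⟩

open scoped Pointwise in
lemma IsAsymptoticDecomposition.symm {S A B : Set ℕ} (h : IsAsymptoticDecomposition S A B) :
    IsAsymptoticDecomposition S B A :=
  ⟨h.pos_right, h.pos_left, h.two_le_right, h.two_le_left, by
    obtain ⟨x₀, hx₀⟩ := h.eventually_eq
    exact ⟨x₀, by rw [add_comm, hx₀]⟩⟩

open scoped Pointwise in
-- Truncating `A` alone at `x₀` already pushes every sum past `x₀`, so `B` is kept whole.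
lemma not_dvd_add_of_mem {T A B : Set ℕ} {x₀ : ℕ}
    (hx₀ : (A + B) ∩ Set.Ici x₀ = primeSemigroup T ∩ Set.Ici x₀) {p a b : ℕ}
    (hp : p ∈ {p : ℕ | p.Prime ∧ p ∉ T}) (ha : a ∈ A ∩ Set.Ici x₀) (hb : b ∈ B) :
    ¬ p ∣ a + b := by
  intro hd
  have h1 : a + b ∈ (A + B) ∩ Set.Ici x₀ :=
    ⟨Set.add_mem_add ha.1 hb, Set.mem_Ici.2 (le_add_right (Set.mem_Ici.1 ha.2))⟩
  rw [hx₀] at h1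
  exact hp.2 (h1.1.2 p hp.1 hd)

open scoped Pointwise in
lemma card_upTo_le_add_mul {S A B : Set ℕ} {x₀ : ℕ}
    (hx₀ : (A + B) ∩ Set.Ici x₀ = S ∩ Set.Ici x₀) (hA : ∀ a ∈ A, 0 < a) (hB : ∀ b ∈ B, 0 < b)
    (x : ℝ) : (upTo S x).card ≤ x₀ + (upTo A x).card * (upTo B x).card := by
  classical
  have h1 : upTo S x ⊆ Finset.range x₀ ∪
      (upTo A x ×ˢ upTo B x).image fun z => z.1 + z.2 := by
    intro n hn
    rw [mem_upTo] at hn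
    rw [Finset.mem_union, Finset.mem_range]
    by_cases hlt : n < x₀
    · exact Or.inl hlt
    · right
      have h2 : n ∈ S ∩ Set.Ici x₀ := ⟨hn.2.2, Set.mem_Ici.2 (not_lt.1 hlt)⟩
      rw [← hx₀] at h2
      obtain ⟨a, ha, b, hb, rfl⟩ := Set.mem_add.1 h2.1
      have hn2 := hn.2.1
      push_cast at hn2
      rw [Finset.mem_image]
      refine ⟨(a, b), Finset.mem_product.2 ⟨mem_upTo.2 ⟨hA a ha, ?_, ha⟩,
        mem_upTo.2 ⟨hB b hb, ?_, hb⟩⟩, rfl⟩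
      · have : (0 : ℝ) ≤ b := Nat.cast_nonneg b
        linarith
      · have : (0 : ℝ) ≤ a := Nat.cast_nonneg a
        linarith
  calc _ ≤ _ := Finset.card_le_card h1
    _ ≤ _ := Finset.card_union_le _ _
    _ ≤ _ := by
      rw [Finset.card_range]
      gcongr
      exact Finset.card_image_le.trans (Finset.card_product _ _).le

lemma card_upTo_le_add (A : Set ℕ) (x₀ : ℕ) (x : ℝ) :
    (upTo A x).card ≤ x₀ + (upTo (A ∩ Set.Ici x₀) x).card := by
  classical
  have h1 : upTo A x ⊆ Finset.range x₀ ∪ upTo (A ∩ Set.Ici x₀) x := by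
    intro n hn
    rw [Finset.mem_union, Finset.mem_range]
    by_cases hlt : n < x₀
    · exact Or.inl hlt
    · rw [mem_upTo] at hn
      exact Or.inr (mem_upTo.2 ⟨hn.1, hn.2.1, hn.2.2, Set.mem_Ici.2 (not_lt.1 hlt)⟩)
  calc _ ≤ _ := Finset.card_le_card h1
    _ ≤ _ := Finset.card_union_le _ _
    _ = _ := by rw [Finset.card_range]

/-- Every finite subset of `A` is eventually contained in `upTo A x`. -/
lemma eventually_subset_upTo {A : Set ℕ} (hA : ∀ a ∈ A, 0 < a) (F : Finset ℕ) (hF : ↑F ⊆ A) :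
    ∀ᶠ x : ℝ in atTop, F ⊆ upTo A x := by
  filter_upwards [eventually_ge_atTop ((F.sup id : ℕ) : ℝ)] with x hx n hn
  have h1 := Finset.le_sup (f := id) hn
  simp only [id] at h1
  have h2 : (n : ℝ) ≤ (F.sup id : ℕ) := by exact_mod_cast h1
  exact mem_upTo.2 ⟨hA n (hF hn), h2.trans hx, hF hn⟩

/-- A cruder lower bound, from the primes of `T` alone. -/
lemma HasLogDensity.exists_le_card_mul_log {T : Set ℕ} {τ C : ℝ} (h : HasLogDensity T τ C)
    (hτ : 0 < τ) : ∃ c : ℝ, 0 < c ∧ ∀ᶠ x : ℝ in atTop,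
      c * x ≤ (upTo (primeSemigroup T) x).card * Real.log x := by
  obtain ⟨H, hH, hθ⟩ := h.exists_sum_log_ge hτ
  refine ⟨1 / H, by positivity, ?_⟩
  filter_upwards [eventually_ge_atTop H] with x hx
  have h1 := hθ x hx
  have hlx : 0 ≤ Real.log x := Real.log_nonneg (by linarith)
  have hsub : upTo T x ⊆ upTo (primeSemigroup T) x := by
    intro p hp
    rw [mem_upTo] at hp
    refine mem_upTo.2 ⟨hp.1, hp.2.1, hp.1, fun q hq hqp => ?_⟩
    rw [(Nat.prime_dvd_prime_iff_eq hq (h.prime p hp.2.2)).1 hqp]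
    exact hp.2.2
  calc 1 / H * x = x / H := by ring
    _ ≤ _ := h1
    _ ≤ (upTo T x).card • Real.log x := by
      apply Finset.sum_le_card_nsmul
      intro p hp
      have hp := mem_upTo.1 hp
      have hp0 : (0 : ℝ) < p := by exact_mod_cast hp.1
      exact Real.log_le_log hp0 hp.2.1
    _ = (upTo T x).card * Real.log x := nsmul_eq_mul _ _
    _ ≤ _ := by
      have : ((upTo T x).card : ℝ) ≤ (upTo (primeSemigroup T) x).card := by
        exact_mod_cast Finset.card_le_card hsub
      gcongr

lemma HasLogDensity.tendsto_card_primeSemigroup {T : Set ℕ} {τ C : ℝ} (h : HasLogDensity T τ C)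
    (hτ : 0 < τ) :
    Tendsto (fun x : ℝ => ((upTo (primeSemigroup T) x).card : ℝ)) atTop atTop := by
  obtain ⟨c, hc, hcx⟩ := h.exists_le_card_mul_log hτ
  have h1 : Tendsto (fun x : ℝ => c * Real.sqrt x / 2) atTop atTop := by
    have h2 := Real.tendsto_sqrt_atTop.const_mul_atTop (by positivity : 0 < c / 2)
    refine h2.congr fun x => ?_
    ring
  refine tendsto_atTop_mono' atTop ?_ h1
  filter_upwards [hcx, eventually_gt_atTop 1] with x hx hx1
  have hx0 : 0 < x := by linarith
  have hs : 0 < Real.sqrt x := Real.sqrt_pos.2 hx0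
  have hss : Real.sqrt x * Real.sqrt x = x := Real.mul_self_sqrt hx0.le
  have hlog : Real.log x ≤ 2 * Real.sqrt x := by
    have h2 := Real.log_le_sub_one_of_pos hs
    rw [Real.log_sqrt hx0.le] at h2
    linarith
  have h3 : c * Real.sqrt x * Real.sqrt x ≤ (upTo (primeSemigroup T) x).card * (2 * Real.sqrt x) := by
    calc c * Real.sqrt x * Real.sqrt x = c * x := by rw [mul_assoc, hss]
      _ ≤ _ := hx
      _ ≤ _ := by gcongr
  have h4 : c * Real.sqrt x ≤ (upTo (primeSemigroup T) x).card * 2 := by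
    apply le_of_mul_le_mul_right _ hs
    linarith
  linarith

lemma HasLogDensity.tendsto_exp_recipSum {U : Set ℕ} {σ C : ℝ} (h : HasLogDensity U σ C)
    (hσ : 0 < σ) (K : ℝ) : ∀ᶠ x : ℝ in atTop, K < Real.exp (recipSum U x) := by
  obtain ⟨r, D, hD, hr⟩ := h.exists_log_pow_le hσ 1
  filter_upwards [eventually_ge_atTop (Real.exp 1),
    Real.tendsto_log_atTop.eventually_gt_atTop (D * (max K 0) ^ r)] with x hx1 hx2
  by_contra hK
  push Not at hK
  have h1 := hr x hx1
  rw [pow_one, Real.exp_nat_mul] at h1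
  have h2 : Real.exp (recipSum U x) ^ r ≤ (max K 0) ^ r :=
    pow_le_pow_left₀ (Real.exp_pos _).le (hK.trans (le_max_left _ _)) r
  have h3 := mul_le_mul_of_nonneg_left h2 hD.le
  linarith

/-! ### Both summands outgrow every power of the logarithm -/

section Decomposition

variable {T A B : Set ℕ} {τ C : ℝ}

/-- If `B` had `r` elements, `2 ≤ r < ∞`, then `A(x) ≪ x exp(-2V)`. But `r A(x) + O(1)` bounds the
count of the semigroup, which is `≫ x exp(-V)`, and `V → ∞`. -/
lemma IsAsymptoticDecomposition.infinite_right
    (hd : IsAsymptoticDecomposition (primeSemigroup T) A B) (h : HasLogDensity T τ C)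
    (hτ0 : 0 < τ) (hτ1 : τ < 1) : B.Infinite := by
  by_contra hfin
  rw [Set.not_infinite] at hfin
  obtain ⟨x₀, hx₀⟩ := hd.eventually_eq
  set B₀ : Finset ℕ := hfin.toFinset with hB₀
  have hr2 : 2 ≤ B₀.card := by
    have h1 := hd.two_le_right
    rw [hfin.encard_eq_coe_toFinset_card] at h1
    exact_mod_cast h1
  set r := B₀.card with hr
  set S : Set ℕ := {p | p.Prime ∧ p ∉ T} with hS
  obtain ⟨c, X₁, hc, hlow⟩ := h.exists_le_card_primeSemigroup hτ0
  obtain ⟨D, X₂, hD, hup⟩ := h.compl.exists_card_le (by linarith) B₀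
  -- This lets the bounded terms be absorbed into half of the semigroup count.
  have hev := (h.tendsto_card_primeSemigroup hτ0).eventually_ge_atTop (2 * (x₀ + x₀ * r))
  obtain ⟨x, hx1, hx2, hxq, hxV, hx0⟩ := ((eventually_ge_atTop X₁).and ((eventually_ge_atTop X₂).and
    (hev.and ((h.compl.tendsto_exp_recipSum (by linarith) (2 * r * D / c)).and
      (eventually_gt_atTop 0))))).exists
  have h1 := hlow x hx1
  have h2 := hup x hx2 (upTo (A ∩ Set.Ici x₀) x) (fun a ha => (mem_upTo.1 ha).2.1)
    (fun p hp a ha b hb => not_dvd_add_of_mem hx₀ hp (mem_upTo.1 ha).2.2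
      ((Set.Finite.mem_toFinset hfin).1 hb))
  have h3 := card_upTo_le_add_mul hx₀ hd.pos_left hd.pos_right x
  have h4 := card_upTo_le_add A x₀ x
  have h5 : (upTo B x).card ≤ r := Finset.card_le_card fun b hb =>
    (Set.Finite.mem_toFinset hfin).2 (mem_upTo.1 hb).2.2
  have h6 : (upTo (primeSemigroup T) x).card
      ≤ x₀ + (x₀ + (upTo (A ∩ Set.Ici x₀) x).card) * r :=
    h3.trans (by gcongr)
  have h7 : ((upTo (primeSemigroup T) x).card : ℝ)
      ≤ x₀ + (x₀ + (upTo (A ∩ Set.Ici x₀) x).card) * r := by exact_mod_cast h6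
  set V := recipSum S x with hV
  have hV0 : 0 ≤ V := recipSum_nonneg S x
  have h8 : Real.exp (-(r * V)) ≤ Real.exp (-V) * Real.exp (-V) := by
    rw [← Real.exp_add]
    apply Real.exp_le_exp.2
    have : (2 : ℝ) ≤ r := by exact_mod_cast hr2
    nlinarith
  have h9 : ((upTo (A ∩ Set.Ici x₀) x).card : ℝ) ≤ D * x * (Real.exp (-V) * Real.exp (-V)) :=
    h2.trans (by gcongr)
  have h10 : c * x * Real.exp (-V) ≤ 2 * (D * x * (Real.exp (-V) * Real.exp (-V)) * r) := by
    have h11 := mul_le_mul_of_nonneg_right h9 (Nat.cast_nonneg (α := ℝ) r)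
    linarith
  have hE := Real.exp_pos (-V)
  have h11 : c ≤ 2 * D * r * Real.exp (-V) := by
    have h12 : c * (x * Real.exp (-V)) ≤ (2 * D * r * Real.exp (-V)) * (x * Real.exp (-V)) := by
      linarith
    exact le_of_mul_le_mul_right h12 (by positivity)
  rw [Real.exp_neg, ← div_eq_mul_inv, le_div_iff₀ (Real.exp_pos _)] at h11
  rw [div_lt_iff₀ hc] at hxV
  linarith

open scoped Pointwise in
lemma IsAsymptoticDecomposition.exists_card_le_mul
    (hd : IsAsymptoticDecomposition (primeSemigroup T) A B) (h : HasLogDensity T τ C)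
    (hτ0 : 0 < τ) (hτ1 : τ < 1) {x₀ : ℕ}
    (hx₀ : (A + B) ∩ Set.Ici x₀ = primeSemigroup T ∩ Set.Ici x₀) :
    ∃ F : ℝ, 0 < F ∧ ∀ᶠ x : ℝ in atTop, ((upTo (primeSemigroup T) x).card : ℝ)
      ≤ F * (upTo (A ∩ Set.Ici x₀) x).card * (upTo B x).card := by
  have hA := hd.symm.infinite_right h hτ0 hτ1
  have hB := hd.infinite_right h hτ0 hτ1
  obtain ⟨b, hb⟩ := hB.nonempty
  obtain ⟨a, ha, hax⟩ := hA.exists_gt x₀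
  refine ⟨2 * x₀ + 1, by positivity, ?_⟩
  filter_upwards [eventually_subset_upTo hd.pos_right {b} (by simpa using hb),
    eventually_subset_upTo (A := A ∩ Set.Ici x₀) (fun a ha => hd.pos_left a ha.1) {a}
      (by simpa using ⟨ha, hax.le⟩)] with x hxb hxa
  have h1 : 1 ≤ (upTo B x).card := by simpa using Finset.card_le_card hxb
  have h2 : 1 ≤ (upTo (A ∩ Set.Ici x₀) x).card := by simpa using Finset.card_le_card hxa
  have h3 := card_upTo_le_add_mul hx₀ hd.pos_left hd.pos_right x
  have h4 := card_upTo_le_add A x₀ x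
  have h5 : (upTo (primeSemigroup T) x).card
      ≤ (2 * x₀ + 1) * (upTo (A ∩ Set.Ici x₀) x).card * (upTo B x).card := by
    set a' := (upTo (A ∩ Set.Ici x₀) x).card
    set b' := (upTo B x).card
    calc _ ≤ x₀ + (x₀ + a') * b' := h3.trans (by gcongr)
      _ ≤ x₀ * (a' * b') + (x₀ * a' + a') * b' := by
        have h6 : 1 ≤ a' * b' := Nat.mul_le_mul h1 h2 |>.trans (by rw [mul_comm])
        have h7 : x₀ ≤ x₀ * (a' * b') := Nat.le_mul_of_pos_right _ h6
        have h8 : x₀ ≤ x₀ * a' := Nat.le_mul_of_pos_right _ h2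
        gcongr
      _ = _ := by ring
  exact_mod_cast h5

/-- Sieving `A` with `r + 1` elements of `B` gives `A(x) ≪ x exp(-(r+1)V)`, which forces `B(x) ≫
exp(rV)`. -/
lemma IsAsymptoticDecomposition.eventually_log_pow_le
    (hd : IsAsymptoticDecomposition (primeSemigroup T) A B) (h : HasLogDensity T τ C)
    (hτ0 : 0 < τ) (hτ1 : τ < 1) (k : ℕ) :
    ∀ᶠ x : ℝ in atTop, Real.log x ^ k ≤ (upTo B x).card := by
  have hB := hd.infinite_right h hτ0 hτ1
  obtain ⟨x₀, hx₀⟩ := hd.eventually_eq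
  obtain ⟨F, hF, hFx⟩ := hd.exists_card_le_mul h hτ0 hτ1 hx₀
  obtain ⟨c, X₁, hc, hlow⟩ := h.exists_le_card_primeSemigroup hτ0
  -- The exponent `k + 1` leaves a spare `log x` to absorb the constants.
  obtain ⟨r, D', hD', hr⟩ := h.compl.exists_log_pow_le (by linarith) (k + 1)
  obtain ⟨B₀, hB₀, hB₀c⟩ := hB.exists_subset_card_eq (r + 1)
  obtain ⟨D, X₂, hD, hup⟩ := h.compl.exists_card_le (by linarith) B₀
  filter_upwards [hFx, eventually_ge_atTop X₁, eventually_ge_atTop X₂,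
    eventually_ge_atTop (Real.exp 1), eventually_gt_atTop 0,
    Real.tendsto_log_atTop.eventually_ge_atTop (D' * (F * D / c)),
    Real.tendsto_log_atTop.eventually_gt_atTop 0] with x h1 hx1 hx2 hx3 hx0 hxl hl0
  have h2 := hlow x hx1
  have h3 := hup x hx2 (upTo (A ∩ Set.Ici x₀) x) (fun a ha => (mem_upTo.1 ha).2.1)
    (fun p hp a ha b hb => not_dvd_add_of_mem hx₀ hp (mem_upTo.1 ha).2.2 (hB₀ hb))
  have h4 := hr x hx3
  set V := recipSum {p | p.Prime ∧ p ∉ T} x with hV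
  set b : ℝ := ((upTo B x).card : ℝ) with hb
  have hb0 : 0 ≤ b := Nat.cast_nonneg _
  rw [hB₀c] at h3
  have h5 : c * x * Real.exp (-V) ≤ F * (D * x * Real.exp (-((r + 1 : ℕ) * V))) * b := by
    refine h2.trans (h1.trans ?_)
    gcongr
  have h6 : Real.exp (-((r + 1 : ℕ) * V)) * Real.exp (r * V) = Real.exp (-V) := by
    rw [← Real.exp_add]; congr 1; push_cast; ring
  have h7 : c * Real.exp (r * V) ≤ F * D * b := by
    have h8 := mul_le_mul_of_nonneg_right h5 (Real.exp_pos (r * V)).le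
    have h9 : (c * Real.exp (r * V)) * (x * Real.exp (-V)) ≤ (F * D * b) * (x * Real.exp (-V)) := by
      calc _ = c * x * Real.exp (-V) * Real.exp (r * V) := by ring
        _ ≤ _ := h8
        _ = F * D * b * x * (Real.exp (-((r + 1 : ℕ) * V)) * Real.exp (r * V)) := by ring
        _ = _ := by rw [h6]; ring
    exact le_of_mul_le_mul_right h9 (by have := Real.exp_pos (-V); positivity)
  have h8 : Real.exp (r * V) ≤ F * D / c * b := by
    rw [div_mul_eq_mul_div, le_div_iff₀ hc]; linarith
  have h9 : Real.log x ^ k * Real.log x ≤ b * Real.log x := by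
    calc Real.log x ^ k * Real.log x = Real.log x ^ (k + 1) := by rw [pow_succ]
      _ ≤ D' * Real.exp (r * V) := h4
      _ ≤ D' * (F * D / c * b) := by gcongr
      _ = (D' * (F * D / c)) * b := by ring
      _ ≤ Real.log x * b := by gcongr
      _ = _ := mul_comm _ _
  exact le_of_mul_le_mul_right h9 hl0

end Decomposition

/-! ### From powers of the logarithm to the square root -/

/-- If `B` has at least `y` elements up to `x`, then the sieve by products of `m` primes of size
about `y` applies to `A`. -/
theorem HasLogDensity.exists_card_mul_pow_le {U : Set ℕ} {σ C : ℝ} (h : HasLogDensity U σ C)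
    (hσ : 0 < σ) : ∃ H : ℝ, 1 < H ∧ ∀ (x y : ℝ) (A B : Finset ℕ) (m : ℕ), 2 ≤ Real.log x →
      H ≤ y → y ≤ x → y ≤ B.card → (∀ a ∈ A, (a : ℝ) ≤ x) → (∀ b ∈ B, (b : ℝ) ≤ x) →
      (∀ p ∈ U, ∀ a ∈ A, ∀ b ∈ B, ¬ p ∣ a + b) → (y ^ m) ^ 2 ≤ x →
      (m : ℝ) ≤ y / (2 * H * Real.log x ^ 2) →
      A.card * ((y / (2 * H * Real.log x ^ 2) - m) / m) ^ m ≤ 2 * Real.exp (4 * Real.pi) * x := by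
  classical
  obtain ⟨H, hH, hw⟩ := h.exists_window hσ
  refine ⟨H, hH, fun x y A B m hlx hy hyx hyB hA hB hAB hym hmW => ?_⟩
  have hH0 : 0 < H := by linarith
  have hy0 : 0 < y := by linarith
  have hy1 : 1 < y := by linarith
  have hx1 : 1 ≤ x := by linarith
  have hwin : ∀ p ∈ upTo U y \ upTo U (y / H), p.Prime ∧ y / H ≤ p ∧ (p : ℝ) ≤ y := by
    intro p hp
    rw [Finset.mem_sdiff, mem_upTo, mem_upTo] at hp
    refine ⟨h.prime p hp.1.2.2, ?_, hp.1.2.1⟩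
    by_contra hlt
    push Not at hlt
    exact hp.2 ⟨hp.1.1, hlt.le, hp.1.2.2⟩
  have h1 := le_sum_residueCount_div B x y H 1 hlx hB hy1 hyB hH0 zero_le_one
    (upTo U y \ upTo U (y / H)) hwin (hw y hy)
  have hly : Real.log y ≤ Real.log x := Real.log_le_log hy0 hyx
  have hly0 : 0 < Real.log y := Real.log_pos hy1
  have h2 : y / (2 * H * Real.log x ^ 2) ≤ 1 ^ 2 * y / (2 * H * Real.log x * Real.log y) := by
    rw [one_pow, one_mul, sq, ← mul_assoc]
    have : 0 < Real.log x := by linarith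
    gcongr
  set M : ℕ := ⌊x⌋₊ + 1 with hM
  have hxM : x ≤ M := by rw [hM]; push_cast; exact (Nat.lt_floor_add_one x).le
  have hM2 : (M : ℝ) ≤ 2 * x := by
    rw [hM]; push_cast
    have := Nat.floor_le (by linarith : 0 ≤ x)
    linarith
  have h3 := card_mul_pow_le A B M (fun n hn => Nat.lt_succ_of_le (Nat.le_floor (hA n hn)))
    (upTo U y \ upTo U (y / H))
    (fun p hp => ⟨(hwin p hp).1, hAB p (mem_upTo.1 (Finset.mem_sdiff.1 hp).1).2.2⟩) y
    (fun p hp => (hwin p hp).2.2) m (hym.trans hxM) _ (h2.trans h1) hmW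
  refine h3.trans ?_
  calc Real.exp (4 * Real.pi) * M ≤ Real.exp (4 * Real.pi) * (2 * x) := by gcongr
    _ = _ := by ring

section Decomposition

variable {T A B : Set ℕ} {τ C : ℝ}

open scoped Pointwise in
-- With `y = (log x)^16` and `m ≈ log x / (32 log log x)`, the sieve gains `((log x)^12)^m ≈
-- x^(12/32) = x^(3/8)`.
lemma IsAsymptoticDecomposition.exists_card_le_rpow
    (hd : IsAsymptoticDecomposition (primeSemigroup T) A B) (h : HasLogDensity T τ C)
    (hτ0 : 0 < τ) (hτ1 : τ < 1) {x₀ : ℕ}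
    (hx₀ : (A + B) ∩ Set.Ici x₀ = primeSemigroup T ∩ Set.Ici x₀) :
    ∃ D : ℝ, 0 < D ∧ ∀ᶠ x : ℝ in atTop, ((upTo (A ∩ Set.Ici x₀) x).card : ℝ)
      ≤ D * x ^ (5 / 8 : ℝ) * Real.log x ^ 12 := by
  obtain ⟨H, hH, hmain⟩ := h.compl.exists_card_mul_pow_le (by linarith)
  have hlo : (fun x : ℝ => Real.log x ^ 16) =o[atTop] fun x : ℝ => x :=
    Real.isLittleO_pow_log_id_atTop
  have hlo2 := hlo.bound one_pos
  refine ⟨2 * Real.exp (4 * Real.pi), by positivity, ?_⟩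
  have hll : Tendsto (fun x : ℝ => Real.log x) atTop atTop := Real.tendsto_log_atTop
  have hlll : (fun x : ℝ => Real.log (Real.log x)) =o[atTop] fun x : ℝ => Real.log x :=
    Real.isLittleO_log_id_atTop.comp_tendsto hll
  have hlll2 := hlll.bound (by norm_num : (0 : ℝ) < 1 / 32)
  filter_upwards [hd.eventually_log_pow_le h hτ0 hτ1 16, eventually_gt_atTop 0, hlo2, hlll2,
    hll.eventually_ge_atTop (4 * H), hll.eventually_ge_atTop 2, hll.eventually_ge_atTop (Real.exp 1)]
    with x hB hx0 hx16 hxll hl4H hl2 hle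
  set l := Real.log x with hl
  have hl0 : 0 < l := by linarith
  have hl1 : 1 ≤ l := by linarith
  set ll := Real.log l with hlldef
  have hll1 : 1 ≤ ll := by
    rw [hlldef, ← Real.log_exp 1]; exact Real.log_le_log (Real.exp_pos _) hle
  have hexpll : Real.exp ll = l := Real.exp_log hl0
  have hexpl : Real.exp l = x := Real.exp_log hx0
  rw [Real.norm_of_nonneg (by positivity), Real.norm_of_nonneg hx0.le, one_mul] at hx16
  rw [Real.norm_of_nonneg (by linarith), Real.norm_of_nonneg hl0.le] at hxll
  -- Here `32 = 2 · 16` ensures `(y ^ m) ^ 2 ≤ x`; rounding down costs at most one factor `l ^ 12`.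
  set m : ℕ := ⌊l / (32 * ll)⌋₊ with hm
  have hm1 : 1 ≤ m := by
    rw [hm, Nat.one_le_floor_iff, one_le_div (by positivity)]; linarith
  have hmr1 : (1 : ℝ) ≤ m := by exact_mod_cast hm1
  have hmle : (m : ℝ) ≤ l / (32 * ll) := Nat.floor_le (by positivity)
  have hmge : l / (32 * ll) - 1 ≤ m := by have := Nat.lt_floor_add_one (l / (32 * ll)); linarith
  have hml : 32 * m * ll ≤ l := by
    rw [le_div_iff₀ (by positivity)] at hmle; linarith
  have hml2 : (m : ℝ) ≤ l := by nlinarith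
  have hml3 : l - 32 * ll ≤ 32 * m * ll := by
    rw [sub_le_iff_le_add, div_le_iff₀ (by positivity)] at hmge; linarith
  set W := l ^ 16 / (2 * H * l ^ 2) with hW
  have hWlow : 2 * l ^ 13 ≤ W := by
    rw [hW, le_div_iff₀ (by positivity)]
    calc 2 * l ^ 13 * (2 * H * l ^ 2) = (4 * H) * l ^ 15 := by ring
      _ ≤ l * l ^ 15 := by gcongr
      _ = l ^ 16 := by ring
  have hl13 : l ≤ l ^ 13 := le_self_pow₀ hl1 (by norm_num)
  have hmW : (m : ℝ) ≤ W := by linarith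
  have hratio : l ^ 12 ≤ (W - m) / m := by
    rw [le_div_iff₀ (by linarith)]
    calc l ^ 12 * m ≤ l ^ 12 * l := by gcongr
      _ = l ^ 13 := by ring
      _ ≤ W - m := by linarith
  have hkey := hmain x (l ^ 16) (upTo (A ∩ Set.Ici x₀) x) (upTo B x) m hl2 (by
      have : l ≤ l ^ 16 := le_self_pow₀ hl1 (by norm_num)
      linarith) hx16 hB (fun a ha => (mem_upTo.1 ha).2.1) (fun b hb => (mem_upTo.1 hb).2.1)
    (fun p hp a ha b hb => not_dvd_add_of_mem hx₀ hp (mem_upTo.1 ha).2.2 (mem_upTo.1 hb).2.2) (by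
      rw [← pow_mul, ← pow_mul, ← mul_assoc]
      calc l ^ (16 * m * 2) = Real.exp ((16 * m * 2 : ℕ) * ll) := by
            rw [Real.exp_nat_mul, hexpll]
        _ ≤ Real.exp l := by
            apply Real.exp_le_exp.2
            push_cast; linarith
        _ = x := hexpl) hmW
  have hpow : x ^ (3 / 8 : ℝ) ≤ ((W - m) / m) ^ m * l ^ 12 := by
    calc x ^ (3 / 8 : ℝ) = Real.exp (l * (3 / 8)) := by rw [Real.rpow_def_of_pos hx0]
      _ ≤ Real.exp ((12 * m : ℕ) * ll + (12 : ℕ) * ll) := by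
        apply Real.exp_le_exp.2
        push_cast; linarith
      _ = (l ^ 12) ^ m * l ^ 12 := by
        rw [Real.exp_add, Real.exp_nat_mul, Real.exp_nat_mul, hexpll, pow_mul]
      _ ≤ _ := by gcongr
  set a : ℝ := ((upTo (A ∩ Set.Ici x₀) x).card : ℝ) with ha
  have ha0 : 0 ≤ a := Nat.cast_nonneg _
  have hx38 : 0 < x ^ (3 / 8 : ℝ) := Real.rpow_pos_of_pos hx0 _
  have hxx : x ^ (5 / 8 : ℝ) * x ^ (3 / 8 : ℝ) = x := by
    rw [← Real.rpow_add hx0]; norm_num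
  have hfin : a * x ^ (3 / 8 : ℝ)
      ≤ (2 * Real.exp (4 * Real.pi) * x ^ (5 / 8 : ℝ) * l ^ 12) * x ^ (3 / 8 : ℝ) := by
    calc a * x ^ (3 / 8 : ℝ) ≤ a * (((W - m) / m) ^ m * l ^ 12) := by gcongr
      _ = (a * ((W - m) / m) ^ m) * l ^ 12 := by ring
      _ ≤ (2 * Real.exp (4 * Real.pi) * x) * l ^ 12 := by gcongr
      _ = (2 * Real.exp (4 * Real.pi) * (x ^ (5 / 8 : ℝ) * x ^ (3 / 8 : ℝ))) * l ^ 12 := by rw [hxx]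
      _ = _ := by ring
  exact le_of_mul_le_mul_right hfin hx38

/-- The semigroup has `≫ x / log x` elements up to `x`, so `B(x) ≫ x^(3/8) / (log x)^13`. -/
lemma IsAsymptoticDecomposition.eventually_rpow_le
    (hd : IsAsymptoticDecomposition (primeSemigroup T) A B) (h : HasLogDensity T τ C)
    (hτ0 : 0 < τ) (hτ1 : τ < 1) :
    ∀ᶠ x : ℝ in atTop, x ^ (1 / 4 : ℝ) ≤ (upTo B x).card := by
  obtain ⟨x₀, hx₀⟩ := hd.eventually_eq
  obtain ⟨F, hF, hFx⟩ := hd.exists_card_le_mul h hτ0 hτ1 hx₀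
  obtain ⟨D, hD, hDx⟩ := hd.exists_card_le_rpow h hτ0 hτ1 hx₀
  obtain ⟨c, hc, hcx⟩ := h.exists_le_card_mul_log hτ0
  have hlo : (fun x : ℝ => Real.log x ^ (13 : ℝ)) =o[atTop] fun x : ℝ => x ^ (1 / 8 : ℝ) :=
    isLittleO_log_rpow_rpow_atTop 13 (by norm_num)
  have hlo2 := hlo.bound (by positivity : 0 < c / (F * D))
  filter_upwards [hFx, hDx, hcx, hlo2, eventually_gt_atTop 0,
    Real.tendsto_log_atTop.eventually_gt_atTop 0] with x h1 h2 h3 h4 hx0 hl0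
  set l := Real.log x with hl
  set b : ℝ := ((upTo B x).card : ℝ) with hb
  have hb0 : 0 ≤ b := Nat.cast_nonneg _
  have h13 : l ^ (13 : ℝ) = l ^ 13 := by exact_mod_cast Real.rpow_natCast l 13
  rw [h13, Real.norm_of_nonneg (by positivity), Real.norm_of_nonneg (by positivity)] at h4
  have h5 : c * x ≤ (F * D * l ^ 13 * b) * x ^ (5 / 8 : ℝ) := by
    calc c * x ≤ _ := h3
      _ ≤ (F * (D * x ^ (5 / 8 : ℝ) * l ^ 12) * b) * l := by
        have : ((upTo (primeSemigroup T) x).card : ℝ) ≤ F * (D * x ^ (5 / 8 : ℝ) * l ^ 12) * b :=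
          h1.trans (by gcongr)
        gcongr
      _ = _ := by ring
  have h6 : F * D * l ^ 13 * b ≤ c * x ^ (1 / 8 : ℝ) * b := by
    have h7 : F * D * l ^ 13 ≤ c * x ^ (1 / 8 : ℝ) := by
      rw [div_mul_eq_mul_div, le_div_iff₀ (by positivity)] at h4
      linarith
    gcongr
  have h58 : 0 < x ^ (5 / 8 : ℝ) := Real.rpow_pos_of_pos hx0 _
  have h18 : 0 < x ^ (1 / 8 : ℝ) := Real.rpow_pos_of_pos hx0 _
  have hxx : x = x ^ (1 / 4 : ℝ) * x ^ (1 / 8 : ℝ) * x ^ (5 / 8 : ℝ) := by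
    rw [← Real.rpow_add hx0, ← Real.rpow_add hx0]; norm_num
  have h8 : x ^ (1 / 4 : ℝ) * (c * x ^ (1 / 8 : ℝ) * x ^ (5 / 8 : ℝ))
      ≤ b * (c * x ^ (1 / 8 : ℝ) * x ^ (5 / 8 : ℝ)) := by
    calc _ = c * (x ^ (1 / 4 : ℝ) * x ^ (1 / 8 : ℝ) * x ^ (5 / 8 : ℝ)) := by ring
      _ = c * x := by rw [← hxx]
      _ ≤ _ := h5
      _ ≤ (c * x ^ (1 / 8 : ℝ) * b) * x ^ (5 / 8 : ℝ) := by gcongr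
      _ = _ := by ring
  exact le_of_mul_le_mul_right h8 (by positivity)

end Decomposition

theorem HasLogDensity.exists_countingFn_le {T : Set ℕ} {τ C : ℝ} (h : HasLogDensity T τ C)
    (hτ0 : 0 < τ) (hτ1 : τ < 1) : ∃ K : ℝ, 0 < K ∧ ∀ A B : Set ℕ,
      IsAsymptoticDecomposition (primeSemigroup T) A B → ∀ᶠ x : ℝ in atTop,
        (countingFn A x : ℝ) ≤ K * (x ^ (1 / 2 : ℝ) * Real.log x ^ 4) := by
  obtain ⟨H, hH, hmain⟩ := h.compl.exists_card_mul_pow_le (by linarith)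
  have hH0 : 0 < H := by linarith
  -- `H` comes from `T` alone. The `64 H²` is from `(W/4)² = y² / (64 H² l⁴)`, and the `1` absorbs
  -- the elements of `A` below `x₀`.
  refine ⟨2 * Real.exp (4 * Real.pi) * (64 * H ^ 2) + 1, by positivity, fun A B hd => ?_⟩
  obtain ⟨x₀, hx₀⟩ := hd.eventually_eq
  have hlo : (fun x : ℝ => Real.log x ^ (2 : ℝ)) =o[atTop] fun x : ℝ => x ^ (1 / 4 : ℝ) :=
    isLittleO_log_rpow_rpow_atTop 2 (by norm_num)
  have hlo2 := hlo.bound (by positivity : 0 < 1 / (8 * H))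
  filter_upwards [hd.eventually_rpow_le h hτ0 hτ1, hlo2, eventually_ge_atTop 1,
    Real.tendsto_log_atTop.eventually_ge_atTop 2,
    (tendsto_rpow_atTop (by norm_num : (0 : ℝ) < 1 / 4)).eventually_ge_atTop H,
    (tendsto_rpow_atTop (by norm_num : (0 : ℝ) < 1 / 2)).eventually_ge_atTop (x₀ : ℝ)]
    with x hB hlog hx1 hl2 hxH hxx₀
  have hx0 : 0 < x := by linarith
  set l := Real.log x with hl
  set y := x ^ (1 / 4 : ℝ) with hy
  have hy2 : y ^ 2 = x ^ (1 / 2 : ℝ) := by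
    rw [hy, ← Real.rpow_natCast, ← Real.rpow_mul hx0.le]; norm_num
  have hy4 : (y ^ 2) ^ 2 = x := by
    rw [← pow_mul, hy, ← Real.rpow_natCast, ← Real.rpow_mul hx0.le]; norm_num
  have hyx : y ≤ x := by
    calc y ≤ x ^ (1 : ℝ) := Real.rpow_le_rpow_of_exponent_le hx1 (by norm_num)
      _ = x := Real.rpow_one x
  have h2 : l ^ (2 : ℝ) = l ^ 2 := by exact_mod_cast Real.rpow_natCast l 2
  rw [h2, Real.norm_of_nonneg (by positivity), Real.norm_of_nonneg (by positivity)] at hlog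
  set W := y / (2 * H * l ^ 2) with hW
  have hl0 : 0 < l := by linarith
  -- With `m = 2`, this gives `(W - 2) / 2 ≥ W / 4`.
  have hW4 : 4 ≤ W := by
    rw [hW, le_div_iff₀ (by positivity)]
    have h3 : 8 * H * l ^ 2 ≤ 8 * H * (1 / (8 * H) * y) := by gcongr
    have h4 : 8 * H * (1 / (8 * H) * y) = y := by field_simp
    linarith
  have hkey := hmain x y (upTo (A ∩ Set.Ici x₀) x) (upTo B x) 2 hl2 hxH hyx hB
    (fun a ha => (mem_upTo.1 ha).2.1) (fun b hb => (mem_upTo.1 hb).2.1)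
    (fun p hp a ha b hb => not_dvd_add_of_mem hx₀ hp (mem_upTo.1 ha).2.2 (mem_upTo.1 hb).2.2)
    hy4.le (by push_cast; linarith)
  push_cast at hkey
  rw [← hW] at hkey
  set a : ℝ := ((upTo (A ∩ Set.Ici x₀) x).card : ℝ) with ha
  have ha0 : 0 ≤ a := Nat.cast_nonneg _
  have h5 : a * (y ^ 2 / (64 * H ^ 2 * l ^ 4)) ≤ 2 * Real.exp (4 * Real.pi) * x := by
    refine le_trans ?_ hkey
    gcongr
    have h6 : y ^ 2 / (64 * H ^ 2 * l ^ 4) = (W / 4) ^ 2 := by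
      rw [hW]; field_simp; ring
    rw [h6]
    exact pow_le_pow_left₀ (by linarith) (by linarith) 2
  have hy0 : 0 < y := by positivity
  have h6 : a ≤ 2 * Real.exp (4 * Real.pi) * (64 * H ^ 2) * (y ^ 2 * l ^ 4) := by
    rw [mul_div_assoc', div_le_iff₀ (by positivity)] at h5
    have h7 : a * y ^ 2 ≤ (2 * Real.exp (4 * Real.pi) * (64 * H ^ 2) * (y ^ 2 * l ^ 4)) * y ^ 2 := by
      calc a * y ^ 2 ≤ 2 * Real.exp (4 * Real.pi) * x * (64 * H ^ 2 * l ^ 4) := h5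
        _ = 2 * Real.exp (4 * Real.pi) * (y ^ 2) ^ 2 * (64 * H ^ 2 * l ^ 4) := by rw [hy4]
        _ = _ := by ring
    exact le_of_mul_le_mul_right h7 (by positivity)
  have h7 : (countingFn A x : ℝ) ≤ x₀ + a := by
    rw [countingFn_eq_card_upTo hd.pos_left, ha]
    exact_mod_cast card_upTo_le_add A x₀ x
  rw [← hy2] at hxx₀ ⊢
  have h8 : y ^ 2 ≤ y ^ 2 * l ^ 4 :=
    le_mul_of_one_le_right (by positivity) (one_le_pow₀ (by linarith))
  linarith

theorem mainTheorem5 (T : Set ℕ) (hT : ∀ p ∈ T, p.Prime) (τ C : ℝ) (hτ0 : 0 < τ) (hτ1 : τ < 1)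
    (hsum : (fun x : ℝ => logPrimeSum T x - (τ * Real.log x + C))
      =o[atTop] (fun _ : ℝ => (1 : ℝ))) :
    ∃ K : ℝ, 0 < K ∧ ∀ A B : Set ℕ, IsAsymptoticDecomposition (primeSemigroup T) A B →
      ∀ᶠ x : ℝ in atTop,
        max (countingFn A x : ℝ) (countingFn B x : ℝ)
          ≤ K * (x ^ (1 / 2 : ℝ) * Real.log x ^ 4) := by
  obtain ⟨C', hC'⟩ := hasLogDensity_of_isLittleO hT hτ0.le hsum
  obtain ⟨K, hK, hmain⟩ := hC'.exists_countingFn_le hτ0 hτ1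
  refine ⟨K, hK, fun A B hd => ?_⟩
  filter_upwards [hmain A B hd, hmain B A hd.symm] with x h1 h2
  exact max_le h1 h2
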